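/- Call a functor $i\colon A\to B$ between small categories a Dwyer map if it is fully faithful and injective on objects; it is a sieve (for every morphism $f\colon b\to i(a)$ of $B$ with $a$ in $A$, both $b$ and $f$ lie in the image of $A$); and there is a full subcategory $W$ of $B$ that is a cosieve in $B$ (every morphism of $B$ whose source is in $W$ has its target in $W$), contains the image of $A$, and is such that the inclusion $A\to W$ has a right adjoint. Call a category strongly connected if for every ordered pair $(x,y)$ of its objects there is a morphism $x\to y$. Write $\mathrm{Fun}(I,A)$ for the category of functors $I\to A$ and natural transformations, and $N$ for the nerve. A morphism of simplicial sets is a weak equivalence if its geometric realization is a homotopy equivalence. **Theorem.** Let $$\begin{array}{ccc} A & \xrightarrow{\;k\;} & C\\ {\scriptstyle i}\downarrow & & \downarrow{\scriptstyle j}\\ B & \xrightarrow{\;h\;} & D\end{array}$$ be a pushout square in the category of small categories such that $i$ is a Dwyer map. Then for every strongly connected small category $I$, the commutative square $$\begin{array}{ccc} \mathrm{Fun}(I,A) & \xrightarrow{\;\mathrm{Fun}(I,k)\;} & \mathrm{Fun}(I,C)\\ {\scriptstyle \mathrm{Fun}(I,i)}\downarrow & & \downarrow{\scriptstyle \mathrm{Fun}(I,j)}\\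 \mathrm{Fun}(I,B) & \xrightarrow{\;\mathrm{Fun}(I,h)\;} & \mathrm{Fun}(I,D)\end{array}$$ is a pushout in the category of small categories, and the canonical morphism $$N\mathrm{Fun}(I,h)\cup N\mathrm{Fun}(I,j)\colon\ N\mathrm{Fun}(I,B)\cup_{N\mathrm{Fun}(I,A)}N\mathrm{Fun}(I,C)\ \longrightarrow\ N\mathrm{Fun}(I,D)$$ is a weak equivalence of simplicial sets. -/

import Mathlib

open CategoryTheory CategoryTheory.Limits

universe u

namespace DwyerPushout

/-- A full subcategory `W` of `B`, given by its objects, is a cosieve if every morphism of `B`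
that starts in `W` also ends in `W` (being full, `W` then contains the morphism as well). -/
def IsCosieve {B : Type u} [Category.{u} B] (W : ObjectProperty B) : Prop :=
  ∀ ⦃w b : B⦄, (w ⟶ b) → W w → W b

/-- A functor `i : A ⥤ B`, regarded as the inclusion of a subcategory, is a sieve if for every
morphism `f : b ⟶ i a` of `B`, both the object `b` and the morphism `f` belong to `A`. -/
def IsSieve {A B : Type u} [Category.{u} A] [Category.{u} B] (i : A ⥤ B) : Prop :=
  ∀ ⦃b : B⦄ ⦃a : A⦄ (f : b ⟶ i.obj a),
    ∃ (a' : A) (h : i.obj a' = b) (g : a' ⟶ a), i.map g = eqToHom h ≫ f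

/-- Dwyer maps between small categories. -/
structure IsDwyerMap {A B : Type u} [Category.{u} A] [Category.{u} B] (i : A ⥤ B) : Prop where
  full : i.Full
  faithful : i.Faithful
  injective_obj : Function.Injective i.obj
  isSieve : IsSieve i
  /-- There is a full subcategory `W` of `B` which is a cosieve, contains `A`, and is such that
  the corestriction `A ⥤ W` of `i` has a right adjoint. -/
  exists_cosieve : ∃ (W : ObjectProperty B) (hW : ∀ a : A, W (i.obj a)),
    IsCosieve W ∧ (W.lift i hW).IsLeftAdjoint

/-- A category is strongly connected if there is a morphism between every ordered pair
of objects. -/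
def IsStronglyConnected (I : Type u) [Category.{u} I] : Prop :=
  ∀ x y : I, Nonempty (x ⟶ y)

/-- A morphism of simplicial sets is a weak equivalence if it becomes a homotopy equivalence
after geometric realization. -/
def IsWeakEquivalence {X Y : SSet.{u}} (f : X ⟶ Y) : Prop :=
  ∃ e : ContinuousMap.HomotopyEquiv (SSet.toTop.obj X) (SSet.toTop.obj Y),
    e.toFun = (SSet.toTop.map f).hom

/-- The simplicial set `N Fun(I, C)`, functorially in the small category `C`. Here
`Cat.exp I` is the functor `Fun(I, -) : Cat ⥤ Cat`. -/
noncomputable abbrev nerveFun (I : Type u) [Category.{u} I] : Cat.{u, u} ⥤ SSet.{u} :=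
  Cat.exp I ⋙ nerveFunctor

/-- For a commutative square of small categories, the canonical morphism
`N Fun(I, h) ∪ N Fun(I, j) : N Fun(I, B) ∪_{N Fun(I, A)} N Fun(I, C) ⟶ N Fun(I, D)`. -/
noncomputable def nerveFunDesc (I : Type u) [Category.{u} I] {A B C D : Cat.{u, u}}
    {i : A ⟶ B} {k : A ⟶ C} {h : B ⟶ D} {j : C ⟶ D} (sq : CommSq i k h j) :
    pushout ((nerveFun I).map i) ((nerveFun I).map k) ⟶ (nerveFun I).obj D :=
  pushout.desc ((nerveFun I).map h) ((nerveFun I).map j) (sq.map (nerveFun I)).w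

end DwyerPushout

/-! A Dwyer map is, up to isomorphism, the inclusion of `A` in a collage. Let `V` be the full
subcategory of `B` on the objects outside `A`. The sieve condition forbids morphisms from `V` to
`A`. The cosieve `W` and the right adjoint `r` of `A ⥤ W` show that morphisms `a ⟶ v` exist only for
`v` in `W`, and are then the morphisms `a ⟶ r v`. So `B` is `Collage R` for the partial functor `R`
from `V` to `A` given by `r` (`IsDwyerMap.exists_collage`). The pushout along `k` changes only the
`A`-part and is `Collage (R.comp k)` (`isPushout_collage`).

If `I` is nonempty and strongly connected, a functor from `I` to a collage lies entirely in `A` or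
entirely in `V`, because `V` is a cosieve. Hence `Fun(I, Collage R)` is again a collage, that of
`R.exp I` (`expCollage_bijective`). The square of functor categories is therefore of the same shape,
which gives the pushout and reduces the second claim to the nerves of one collage square. For empty
`I` all functor categories are terminal.

For the nerves (`isWeakEquivalence_collage`), a homotopy inverse is written down on geometric
realizations. A chain in a collage has a head in `A` and a tail in `V`. If the head is nonempty, the
chain lies in the subcategory `nearA`, which coreflects onto `A` with counit `R v ⟶ v`. Let `t` be
the mass of the tail. Points with `t ≤ 1/2` are moved into `A` by the coreflection while mass flows
from head to tail. At `t = 1/2` the head is empty, and for `t ≥ 1/2` the point climbs along the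
counit over the tail, reaching `V` at `t = 1`. This deformation (`deform`) fixes `A` and `V`. Its
end result only involves chains in `A`, chains in `V` and counit arrows over the domain of `R`. In
`Collage (R.comp k)` all of these come from `C` or from `Collage R`, so the result lifts to the
pushout of nerves (`inverse`). -/

namespace DwyerPushout
open Simplicial Opposite

/-! ### Maps out of a geometric realization, simplex by simplex. -/

section Realization

variable {X Y : SSet.{u}} {T : TopCat.{u}}

/-- The points of the geometric realization that lie on a given simplex, in terms of
barycentric coordinates. -/
noncomputable def simplexPoint {n : ℕ} (σ : X _⦋n⦌) :
    C(stdSimplex ℝ (Fin (n + 1)), SSet.toTop.obj X) :=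
  TopCat.toSSetObjEquiv _ (op ⦋n⦌) ((sSetTopAdj.unit.app X).app _ σ)

lemma map_simplexPoint (f : X ⟶ Y) {n : ℕ} (σ : X _⦋n⦌) (x : stdSimplex ℝ (Fin (n + 1))) :
    (SSet.toTop.map f).hom (simplexPoint σ x) = simplexPoint (f.app _ σ) x := by
  have h := ConcreteCategory.congr_hom
    (congr_app (sSetTopAdj.unit.naturality f) (op ⦋n⦌)) σ
  have h2 := congrArg (fun z => TopCat.toSSetObjEquiv _ (op ⦋n⦌) z x) h
  exact h2.symm

lemma simplexPoint_map {n p : ℕ} (α : ⦋p⦌ ⟶ ⦋n⦌) (σ : X _⦋n⦌)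
    (y : stdSimplex ℝ (Fin (p + 1))) :
    simplexPoint (X.map α.op σ) y = simplexPoint σ (stdSimplex.map α y) := by
  have h := ConcreteCategory.congr_hom ((sSetTopAdj.unit.app X).naturality α.op) σ
  have h2 := congrArg (fun z => TopCat.toSSetObjEquiv _ (op ⦋p⦌) z y) h
  exact h2

/-- A compatible family of continuous maps defined on the simplices of a simplicial set. -/
structure SimplexFamily (X : SSet.{u}) (T : TopCat.{u}) where
  /-- the map on each simplex -/
  toFun : ∀ {n : ℕ}, X _⦋n⦌ → C(stdSimplex ℝ (Fin (n + 1)), T)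
  naturality : ∀ {n p : ℕ} (α : ⦋p⦌ ⟶ ⦋n⦌) (σ : X _⦋n⦌) (y : stdSimplex ℝ (Fin (p + 1))),
    toFun (X.map α.op σ) y = toFun σ (stdSimplex.map α y)

/-- The map from the geometric realization given by a compatible family. -/
noncomputable def SimplexFamily.desc (F : SimplexFamily X T) : SSet.toTop.obj X ⟶ T :=
  (sSetTopAdj.homEquiv X T).symm
    { app := fun Δ => TypeCat.ofHom fun σ =>
        (TopCat.toSSetObjEquiv T Δ).symm (F.toFun (n := Δ.unop.len) σ)
      naturality := by
        intro Δ Δ' α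
        ext σ
        apply (TopCat.toSSetObjEquiv T Δ').injective
        ext y
        exact F.naturality (n := Δ.unop.len) (p := Δ'.unop.len) α.unop σ y }

lemma SimplexFamily.desc_simplexPoint (F : SimplexFamily X T) {n : ℕ} (σ : X _⦋n⦌)
    (x : stdSimplex ℝ (Fin (n + 1))) : F.desc.hom (simplexPoint σ x) = F.toFun σ x := by
  have h := (sSetTopAdj.homEquiv X T).apply_symm_apply
    { app := fun Δ => TypeCat.ofHom fun σ =>
        (TopCat.toSSetObjEquiv T Δ).symm (F.toFun (n := Δ.unop.len) σ)
      naturality := by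
        intro Δ Δ' α
        ext σ
        apply (TopCat.toSSetObjEquiv T Δ').injective
        ext y
        exact F.naturality (n := Δ.unop.len) (p := Δ'.unop.len) α.unop σ y }
  rw [Adjunction.homEquiv_unit] at h
  have h2 := ConcreteCategory.congr_hom (congr_app h (op ⦋n⦌)) σ
  exact congrArg (fun z => TopCat.toSSetObjEquiv _ (op ⦋n⦌) z x) h2

lemma toTop_hom_ext {f g : SSet.toTop.obj X ⟶ T}
    (h : ∀ (n : ℕ) (σ : X _⦋n⦌) (x : stdSimplex ℝ (Fin (n + 1))),
      f.hom (simplexPoint σ x) = g.hom (simplexPoint σ x)) : f = g := by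
  apply (sSetTopAdj.homEquiv X T).injective
  ext Δ σ
  rw [Adjunction.homEquiv_unit, Adjunction.homEquiv_unit]
  apply (TopCat.toSSetObjEquiv T Δ).injective
  ext y
  exact h Δ.unop.len σ y

end Realization
end DwyerPushout

namespace DwyerPushout
open Simplicial Opposite

/-! ### Points of simplices as mass distributions. -/

section StdSimplex

lemma stdSimplex_map_apply {X Y : Type*} [Fintype X] [Fintype Y] [DecidableEq Y] (f : X → Y)
    (s : stdSimplex ℝ X) (y : Y) :
    stdSimplex.map f s y = ∑ x with f x = y, s x := by
  rw [stdSimplex.map_coe, FunOnFinite.linearMap_apply_apply]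

lemma stdSimplex_map_map {X Y Z : Type*} [Fintype X] [Fintype Y] [Fintype Z] {f : X → Y}
    {g : Y → Z} {h : X → Z} (e : ∀ x, h x = g (f x)) (s : stdSimplex ℝ X) :
    stdSimplex.map g (stdSimplex.map f s) = stdSimplex.map h s := by
  obtain rfl : h = g ∘ f := funext e
  exact stdSimplex.map_comp_apply f g s

lemma stdSimplex_map_eq {X Y : Type*} [Fintype X] [Fintype Y] {f : X → Y}
    (hf : Function.Injective f) (μ : stdSimplex ℝ Y) (s : stdSimplex ℝ X)
    (h : ∀ x, s x = μ (f x)) (h0 : ∀ y, y ∉ Set.range f → μ y = 0) :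
    stdSimplex.map f s = μ := by
  classical
  ext y
  rw [stdSimplex_map_apply]
  by_cases hy : y ∈ Set.range f
  · obtain ⟨x, rfl⟩ := hy
    rw [Finset.sum_eq_single x]
    · exact h x
    · intro b hb hbx
      exact absurd (hf (Finset.mem_filter.1 hb).2) hbx
    · simp
  · rw [h0 y hy]
    apply Finset.sum_eq_zero
    intro x hx
    exact absurd ⟨x, (Finset.mem_filter.1 hx).2⟩ hy

lemma exists_stdSimplex_of_range {X Y : Type*} [Fintype X] [Fintype Y] {f : X → Y}
    (hf : Function.Injective f) (μ : stdSimplex ℝ Y) (h0 : ∀ y, y ∉ Set.range f → μ y = 0) :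
    ∑ x, μ (f x) = 1 := by
  classical
  rw [← stdSimplex.sum_eq_one μ, ← Finset.sum_image (f := fun y => μ y) (s := Finset.univ) (g := f)
    (fun x _ y _ h => hf h)]
  apply Finset.sum_subset (Finset.subset_univ _)
  intro y _ hy
  apply h0
  rintro ⟨x, rfl⟩
  exact hy (Finset.mem_image_of_mem _ (Finset.mem_univ _))

/-- The point of the simplex on `X` given by a point of the simplex on `Y` that is supported on
the image of an injective map. -/
def stdSimplexComap {X Y : Type*} [Fintype X] [Fintype Y] {f : X → Y}
    (hf : Function.Injective f) (μ : stdSimplex ℝ Y) (h0 : ∀ y, y ∉ Set.range f → μ y = 0) :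
    stdSimplex ℝ X :=
  ⟨fun x => μ (f x), fun x => stdSimplex.zero_le μ (f x), exists_stdSimplex_of_range hf μ h0⟩

lemma map_stdSimplexComap {X Y : Type*} [Fintype X] [Fintype Y] {f : X → Y}
    (hf : Function.Injective f) (μ : stdSimplex ℝ Y) (h0 : ∀ y, y ∉ Set.range f → μ y = 0) :
    stdSimplex.map f (stdSimplexComap hf μ h0) = μ :=
  stdSimplex_map_eq hf μ _ (fun _ => rfl) h0

/-- Take the face spanned by the vertices of positive mass; every point is interior to some face. -/
lemma exists_pos_stdSimplex {q : ℕ} (y : stdSimplex ℝ (Fin (q + 1))) :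
    ∃ (k : ℕ) (e : Fin (k + 1) →o Fin (q + 1)) (y' : stdSimplex ℝ (Fin (k + 1))),
      stdSimplex.map e y' = y ∧ ∀ i, 0 < y' i := by
  classical
  let T : Finset (Fin (q + 1)) := Finset.univ.filter fun i => 0 < y i
  have hT : T.Nonempty := by
    by_contra h
    rw [Finset.not_nonempty_iff_eq_empty] at h
    have h1 : ∑ i, y i = 0 := by
      apply Finset.sum_eq_zero
      intro i _
      have : i ∉ T := by rw [h]; simp
      have h2 : ¬ 0 < y i := by simpa [T] using this
      exact le_antisymm (not_lt.1 h2) (stdSimplex.zero_le y i)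
    rw [stdSimplex.sum_eq_one] at h1
    exact one_ne_zero h1
  obtain ⟨k, hk⟩ : ∃ k, T.card = k + 1 := ⟨T.card - 1, by have := hT.card_pos; omega⟩
  let e := T.orderEmbOfFin hk
  have h0 : ∀ i, i ∉ Set.range e → y i = 0 := by
    intro i hi
    rw [Finset.range_orderEmbOfFin] at hi
    have h2 : ¬ 0 < y i := by simpa [T] using hi
    exact le_antisymm (not_lt.1 h2) (stdSimplex.zero_le y i)
  refine ⟨k, e.toOrderHom, stdSimplexComap e.injective y h0, map_stdSimplexComap e.injective y h0,
    fun i => ?_⟩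
  have : e i ∈ T := T.orderEmbOfFin_mem hk i
  exact (Finset.mem_filter.1 this).2

end StdSimplex

/-! ### Points of a realized nerve given by masses on a chain of a poset. -/

section NervePoint

variable {D E : Type u} [Category.{u} D] [Category.{u} E]

/-- The points of the realization of a nerve that lie on a given chain. -/
noncomputable def nervePoint {n : ℕ} (F : Fin (n + 1) ⥤ D) :
    C(stdSimplex ℝ (Fin (n + 1)), SSet.toTop.obj (nerve D)) :=
  simplexPoint (X := nerve D) (n := n) F

lemma nervePoint_eq {n : ℕ} (F : Fin (n + 1) ⥤ D) :
    nervePoint F = simplexPoint (X := nerve D) (n := n) F := rfl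

lemma map_nervePoint (L : D ⥤ E) {n : ℕ} (F : Fin (n + 1) ⥤ D) (x : stdSimplex ℝ (Fin (n + 1))) :
    (SSet.toTop.map (nerveMap L)).hom (nervePoint F x) = nervePoint (F ⋙ L) x :=
  map_simplexPoint _ _ _

lemma nervePoint_comp {n p : ℕ} (α : Fin (p + 1) →o Fin (n + 1)) (F : Fin (n + 1) ⥤ D)
    (y : stdSimplex ℝ (Fin (p + 1))) :
    nervePoint (α.monotone.functor ⋙ F) y = nervePoint F (stdSimplex.map α y) :=
  simplexPoint_map (X := nerve D) (SimplexCategory.Hom.mk (a := ⦋p⦌) (b := ⦋n⦌) α) F y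

attribute [irreducible] nervePoint

variable {Λ : Type*} [PartialOrder Λ] [Fintype Λ]

omit [Fintype Λ] in
lemma nervePoint_chain_comp (G : Λ ⥤ D) {q p : ℕ} (β : Fin (p + 1) →o Λ)
    (ζ : Fin (q + 1) →o Fin (p + 1)) (y : stdSimplex ℝ (Fin (q + 1))) :
    nervePoint ((β.comp ζ).monotone.functor ⋙ G) y =
      nervePoint (β.monotone.functor ⋙ G) (stdSimplex.map ζ y) := by
  rw [← nervePoint_comp]
  rfl

/-- A section `t` of `β` over its image is monotone there, since `β` is a chain. Both `α` and `β`
then factor through `β`, by `ζ` and `ψ`, and the two points of the simplex of `β` so obtained are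
the same image of the common mass distribution. The map `ψ` is needed because `β` may repeat
vertices. -/
lemma nervePoint_eq_of_surj (G : Λ ⥤ D) {q p : ℕ} (α : Fin (q + 1) →o Λ) (β : Fin (p + 1) →o Λ)
    (y : stdSimplex ℝ (Fin (q + 1))) (z : stdSimplex ℝ (Fin (p + 1)))
    (hαβ : ∀ i, ∃ j, β j = α i)
    (h : stdSimplex.map α y = stdSimplex.map β z) :
    nervePoint (α.monotone.functor ⋙ G) y = nervePoint (β.monotone.functor ⋙ G) z := by
  classical
  let t : Λ → Fin (p + 1) := Function.invFun β
  have ht : ∀ l, (∃ j, β j = l) → β (t l) = l := fun l hl => Function.invFun_eq hl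
  have mono : ∀ l l', (∃ j, β j = l) → (∃ j, β j = l') → l ≤ l' → t l ≤ t l' := by
    intro l l' hl hl' hle
    rcases hle.eq_or_lt with rfl | hlt
    · exact le_rfl
    · by_contra hcon
      have := β.monotone (not_le.1 hcon).le
      rw [ht l hl, ht l' hl'] at this
      exact absurd (hlt.trans_le this) (lt_irrefl _)
  let ζ : Fin (q + 1) →o Fin (p + 1) :=
    ⟨fun i => t (α i), fun i j hij => mono _ _ (hαβ i) (hαβ j) (α.monotone hij)⟩
  let ψ : Fin (p + 1) →o Fin (p + 1) :=
    ⟨fun i => t (β i), fun i j hij => mono _ _ ⟨i, rfl⟩ ⟨j, rfl⟩ (β.monotone hij)⟩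
  have hζ : α = β.comp ζ := by
    ext i
    exact (ht _ (hαβ i)).symm
  have hψ : β = β.comp ψ := by
    ext i
    exact (ht _ ⟨i, rfl⟩).symm
  have key : stdSimplex.map ζ y = stdSimplex.map ψ z := by
    have e1 : stdSimplex.map ζ y = stdSimplex.map t (stdSimplex.map α y) :=
      (stdSimplex_map_map (by intro _; rfl) _).symm
    have e2 : stdSimplex.map ψ z = stdSimplex.map t (stdSimplex.map β z) :=
      (stdSimplex_map_map (by intro _; rfl) _).symm
    rw [e1, e2, h]
  have s1 := nervePoint_chain_comp G β ζ y
  have s2 := nervePoint_chain_comp G β ψ z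
  rw [← hζ] at s1
  rw [← hψ] at s2
  rw [s1, s2, key]

/-- A point on a chain in a poset `Λ` over `D` depends only on its mass distribution on `Λ`. -/
lemma nervePoint_eq_of_map_eq (G : Λ ⥤ D) {q p : ℕ} (α : Fin (q + 1) →o Λ)
    (β : Fin (p + 1) →o Λ) (y : stdSimplex ℝ (Fin (q + 1))) (z : stdSimplex ℝ (Fin (p + 1)))
    (h : stdSimplex.map α y = stdSimplex.map β z) :
    nervePoint (α.monotone.functor ⋙ G) y = nervePoint (β.monotone.functor ⋙ G) z := by
  classical
  -- With all masses positive, every vertex of `α` carries mass and so must occur in `β`.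
  obtain ⟨k, e, y', rfl, hy'⟩ := exists_pos_stdSimplex y
  rw [← nervePoint_chain_comp]
  have h' : stdSimplex.map (α.comp e) y' = stdSimplex.map β z := by
    rw [← h]
    exact (stdSimplex_map_map (by intro _; rfl) _).symm
  apply nervePoint_eq_of_surj G _ _ _ _ _ h'
  intro i
  by_contra hi
  push Not at hi
  have : stdSimplex.map β z (α.comp e i) = 0 := by
    rw [stdSimplex_map_apply]
    apply Finset.sum_eq_zero
    intro j hj
    exact absurd (Finset.mem_filter.1 hj).2 (hi j)
  rw [← h', stdSimplex_map_apply] at this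
  have h3 := (Finset.sum_eq_zero_iff_of_nonneg (fun j _ => stdSimplex.zero_le y' j)).1 this i
    (by simp)
  exact (hy' i).ne' h3

/-- A mass distribution on a poset is carried by a chain. -/
def IsChainMass (μ : stdSimplex ℝ Λ) : Prop :=
  ∃ (n : ℕ) (α : Fin (n + 1) →o Λ) (y : stdSimplex ℝ (Fin (n + 1))), stdSimplex.map α y = μ

/-- The point of the realization of `nerve D` given by a functor `Λ ⥤ D` from a poset and a mass
distribution carried by a chain of `Λ`. -/
noncomputable def massPoint (G : Λ ⥤ D) (μ : stdSimplex ℝ Λ) (h : IsChainMass μ) :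
    SSet.toTop.obj (nerve D) :=
  nervePoint (h.choose_spec.choose.monotone.functor ⋙ G) h.choose_spec.choose_spec.choose

/-- The chain chosen in `massPoint` is immaterial: any chain carrying the mass computes it. -/
lemma massPoint_eq (G : Λ ⥤ D) {μ : stdSimplex ℝ Λ} (h : IsChainMass μ) {n : ℕ}
    (α : Fin (n + 1) →o Λ) (y : stdSimplex ℝ (Fin (n + 1))) (hy : stdSimplex.map α y = μ) :
    massPoint G μ h = nervePoint (α.monotone.functor ⋙ G) y :=
  nervePoint_eq_of_map_eq G _ _ _ _ (h.choose_spec.choose_spec.choose_spec.trans hy.symm)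

lemma massPoint_map {Λ' : Type*} [PartialOrder Λ'] [Fintype Λ'] (G : Λ' ⥤ D)
    {μ : stdSimplex ℝ Λ} (h : IsChainMass μ) (f : Λ →o Λ') {μ' : stdSimplex ℝ Λ'}
    (h' : IsChainMass μ') (e : stdSimplex.map f μ = μ') :
    massPoint G μ' h' = massPoint (f.monotone.functor ⋙ G) μ h := by
  subst e
  obtain ⟨n, α, y, rfl⟩ := id h
  rw [massPoint_eq _ h α y rfl, massPoint_eq G h' (f.comp α) y
    (stdSimplex_map_map (by intro _; rfl) _).symm]
  rfl

lemma map_massPoint (G : Λ ⥤ D) (L : D ⥤ E) {μ : stdSimplex ℝ Λ} (h : IsChainMass μ) :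
    (SSet.toTop.map (nerveMap L)).hom (massPoint G μ h) = massPoint (G ⋙ L) μ h := by
  obtain ⟨n, α, y, rfl⟩ := id h
  rw [massPoint_eq _ h α y rfl, massPoint_eq _ h α y rfl, map_nervePoint]
  rfl

/-- The sets on which the mass is supported on one chain `α j` are closed, finite in number and
cover `Y`. On each of them the coordinates along `α j` vary continuously, and the pieces glue. -/
lemma continuous_massPoint {Y : Type*} [TopologicalSpace Y] (G : Λ ⥤ D)
    (m : Y → stdSimplex ℝ Λ) (hm : Continuous m) (h : ∀ y, IsChainMass (m y))
    {J : Type*} [Finite J] (n : J → ℕ) (α : ∀ j, Fin (n j + 1) →o Λ)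
    (hα : ∀ j, Function.Injective (α j))
    (hcov : ∀ y, ∃ j, ∀ l, l ∉ Set.range (α j) → m y l = 0) :
    Continuous fun y => massPoint G (m y) (h y) := by
  let S : J → Set Y := fun j => {y | ∀ l, l ∉ Set.range (α j) → m y l = 0}
  have hmc : ∀ l, Continuous fun y => m y l := fun l =>
    (continuous_apply l).comp (continuous_subtype_val.comp hm)
  refine (locallyFinite_of_finite S).continuous ?_ ?_ ?_
  · exact Set.eq_univ_of_forall fun y => Set.mem_iUnion.2 (hcov y)
  · intro j
    simp only [S, Set.ofPred_forall]
    exact isClosed_iInter fun l => isClosed_iInter fun _ => isClosed_eq (hmc l) continuous_const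
  · intro j
    rw [continuousOn_iff_continuous_domRestrict]
    have e : (S j).domRestrict (fun y => massPoint G (m y) (h y)) =
        fun y : S j => nervePoint ((α j).monotone.functor ⋙ G)
          (stdSimplexComap (hα j) (m y.1) y.2) := by
      funext y
      exact massPoint_eq G _ _ _ (map_stdSimplexComap (hα j) (m y.1) y.2)
    rw [e]
    refine (nervePoint _).continuous.comp (Continuous.subtype_mk ?_ _)
    exact continuous_pi fun i => (hmc _).comp continuous_subtype_val

end NervePoint
end DwyerPushout

/-! ### The prism: triangulating the product of a simplex and an interval. -/

namespace DwyerPushout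
open Simplicial Opposite

/-- The poset `[n] × [1]`. -/
def Prism (n : ℕ) : Type := Fin (n + 1) × Bool

instance (n : ℕ) : PartialOrder (Prism n) := inferInstanceAs (PartialOrder (Fin (n + 1) × Bool))

instance (n : ℕ) : Fintype (Prism n) := inferInstanceAs (Fintype (Fin (n + 1) × Bool))

instance (n : ℕ) : DecidableEq (Prism n) := inferInstanceAs (DecidableEq (Fin (n + 1) × Bool))

/-- The elements of `[n] × [1]`. -/
def Prism.mk {n : ℕ} (i : Fin (n + 1)) (b : Bool) : Prism n := (i, b)

lemma Prism.not_le {n : ℕ} {i j : Fin (n + 1)} (h : Prism.mk i true ≤ Prism.mk j false) :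
    False := absurd h.2 (by decide : ¬ (true ≤ false))

lemma sum_prism {n : ℕ} (f : Prism n → ℝ) :
    ∑ p, f p = ∑ i, (f (.mk i true) + f (.mk i false)) := by
  refine (Fintype.sum_prod_type (γ := ℝ) (f := f)).trans ?_
  simp only [Fintype.sum_bool]
  rfl

section PrismMass

variable {n : ℕ}

/-- Reading the masses of `x` from left to right, the part of the mass at `i` that is among the
first `c` units. -/
noncomputable def lowerMass (x : stdSimplex ℝ (Fin (n + 1))) (c : ℝ) (i : Fin (n + 1)) : ℝ :=
  min c (∑ k ∈ Finset.Iic i, x k) - min c (∑ k ∈ Finset.Iio i, x k)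

lemma sum_Iic_eq (x : stdSimplex ℝ (Fin (n + 1))) (i : Fin (n + 1)) :
    ∑ k ∈ Finset.Iic i, x k = x i + ∑ k ∈ Finset.Iio i, x k := by
  rw [← Finset.Iio_insert, Finset.sum_insert (by simp)]

lemma lowerMass_nonneg (x : stdSimplex ℝ (Fin (n + 1))) (c : ℝ) (i : Fin (n + 1)) :
    0 ≤ lowerMass x c i := by
  have := stdSimplex.zero_le x i
  rw [lowerMass, sum_Iic_eq, sub_nonneg]
  exact min_le_min le_rfl (by linarith)

lemma lowerMass_le (x : stdSimplex ℝ (Fin (n + 1))) (c : ℝ) (i : Fin (n + 1)) :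
    lowerMass x c i ≤ x i := by
  have := stdSimplex.zero_le x i
  rw [lowerMass, sum_Iic_eq, sub_le_iff_le_add, ← min_add_add_left]
  exact min_le_min (by linarith) le_rfl

/-- The sum telescopes over an initial segment; `0 ≤ c` is what the empty segment needs. -/
lemma sum_lowerMass (x : stdSimplex ℝ (Fin (n + 1))) {c : ℝ} (hc : 0 ≤ c)
    (S : Finset (Fin (n + 1))) (hS : IsLowerSet (S : Set (Fin (n + 1)))) :
    ∑ i ∈ S, lowerMass x c i = min c (∑ i ∈ S, x i) := by
  induction S using Finset.induction_on_max with
  | empty => simp [hc]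
  | insert a s hs ih =>
    have hs' : s = Finset.Iio a := by
      ext b
      rw [Finset.mem_Iio]
      refine ⟨hs b, fun hb => ?_⟩
      have : b ∈ ((insert a s : Finset _) : Set (Fin (n + 1))) := hS hb.le (by simp)
      simpa [hb.ne] using this
    have ha : a ∉ s := fun h => lt_irrefl _ (hs a h)
    rw [Finset.sum_insert ha, Finset.sum_insert ha, ih, lowerMass, sum_Iic_eq, hs']
    · ring
    · rw [hs', Finset.coe_Iio]
      exact isLowerSet_Iio a

/-- A fiber of a monotone map is the difference of the initial segments `α i ≤ j` and `α i < j`, and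
`sum_lowerMass` evaluates both. This makes the subdivision of the prism natural in the simplex. -/
lemma sum_lowerMass_fiber {p : ℕ} (y : stdSimplex ℝ (Fin (p + 1))) {c : ℝ} (hc : 0 ≤ c)
    (α : Fin (p + 1) →o Fin (n + 1)) (j : Fin (n + 1)) :
    ∑ i with α i = j, lowerMass y c i = lowerMass (stdSimplex.map α y) c j := by
  have key : ∀ (P : Fin (n + 1) → Prop) [DecidablePred P], (∀ a b, a ≤ b → P b → P a) →
      min c (∑ k with P k, stdSimplex.map α y k) = ∑ i with P (α i), lowerMass y c i := by
    intro P _ hP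
    rw [sum_lowerMass y hc]
    · congr 1
      simp only [stdSimplex_map_apply]
      rw [Finset.sum_filter, Finset.sum_filter,
        ← Finset.sum_fiberwise Finset.univ α (fun i => if P (α i) then y i else 0)]
      refine Finset.sum_congr rfl fun k _ => ?_
      split_ifs with hk
      · refine Finset.sum_congr rfl fun i hi => ?_
        rw [if_pos (by rw [(Finset.mem_filter.1 hi).2]; exact hk)]
      · symm
        refine Finset.sum_eq_zero fun i hi => ?_
        rw [if_neg (by rw [(Finset.mem_filter.1 hi).2]; exact hk)]
    · intro a b hab hb
      simp only [Finset.coe_filter, Finset.mem_univ, true_and, Set.mem_ofPred_eq] at hb ⊢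
      exact hP _ _ (α.monotone hab) hb
  have e1 := key (· ≤ j) (fun a b hab hb => hab.trans hb)
  have e2 := key (· < j) (fun a b hab hb => hab.trans_lt hb)
  have f1 : Finset.univ.filter (· ≤ j) = Finset.Iic j := by ext; simp
  have f2 : Finset.univ.filter (· < j) = Finset.Iio j := by ext; simp
  rw [f1] at e1
  rw [f2] at e2
  rw [lowerMass, e1, e2, eq_sub_iff_add_eq, ← Finset.sum_union]
  · refine Finset.sum_congr ?_ fun _ _ => rfl
    ext i
    simp only [Finset.mem_union, Finset.mem_filter, Finset.mem_univ, true_and]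
    exact le_iff_eq_or_lt.symm
  · rw [Finset.disjoint_left]
    intro i hi hi'
    simp only [Finset.mem_filter, Finset.mem_univ, true_and] at hi hi'
    exact hi'.ne hi

/-- The mass distribution on `[n] × [1]` corresponding to a point of `Δⁿ × [0, 1]`. -/
noncomputable def prismMass (x : stdSimplex ℝ (Fin (n + 1))) (s : unitInterval) :
    stdSimplex ℝ (Prism n) :=
  ⟨fun p => if p.2 then x p.1 - lowerMass x (1 - s) p.1 else lowerMass x (1 - s) p.1, by
    refine ⟨?_, ?_⟩
    · rintro ⟨i, _ | _⟩
      · simpa using lowerMass_nonneg x _ i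
      · simpa using lowerMass_le x _ i
    · rw [sum_prism, ← stdSimplex.sum_eq_one x]
      exact Finset.sum_congr rfl fun i _ => sub_add_cancel _ _⟩

@[simp]
lemma prismMass_false (x : stdSimplex ℝ (Fin (n + 1))) (s : unitInterval) (i : Fin (n + 1)) :
    prismMass x s (.mk i false) = lowerMass x (1 - s) i := rfl

@[simp]
lemma prismMass_true (x : stdSimplex ℝ (Fin (n + 1))) (s : unitInterval) (i : Fin (n + 1)) :
    prismMass x s (.mk i true) = x i - lowerMass x (1 - s) i := rfl

lemma continuous_prismMass :
    Continuous fun q : stdSimplex ℝ (Fin (n + 1)) × unitInterval => prismMass q.1 q.2 := by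
  have hx : ∀ k, Continuous fun q : stdSimplex ℝ (Fin (n + 1)) × unitInterval => q.1 k := fun k =>
    (continuous_apply k).comp (continuous_subtype_val.comp continuous_fst)
  have hl : ∀ i, Continuous fun q : stdSimplex ℝ (Fin (n + 1)) × unitInterval =>
      lowerMass q.1 (1 - q.2) i := by
    intro i
    unfold lowerMass
    fun_prop
  refine Continuous.subtype_mk (continuous_pi ?_) _
  rintro ⟨i, _ | _⟩
  · exact hl i
  · exact (hx i).sub (hl i)

/-- A monotone map acts on `[n] × [1]` through the first factor. -/
def prodBoolMap {p : ℕ} (α : Fin (p + 1) →o Fin (n + 1)) :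
    Prism p →o Prism n :=
  ⟨Prod.map α id, fun _ _ h => ⟨α.monotone h.1, h.2⟩⟩

lemma map_prismMass {p : ℕ} (α : Fin (p + 1) →o Fin (n + 1)) (y : stdSimplex ℝ (Fin (p + 1)))
    (s : unitInterval) :
    stdSimplex.map (prodBoolMap α) (prismMass y s) = prismMass (stdSimplex.map α y) s := by
  have hc : 0 ≤ 1 - (s : ℝ) := sub_nonneg.2 s.2.2
  have key : ∀ (j : Fin (n + 1)) (b : Bool),
      stdSimplex.map (prodBoolMap α) (prismMass y s) (.mk j b) =
        ∑ i with α i = j, prismMass y s (.mk i b) := by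
    intro j b
    rw [stdSimplex_map_apply, Finset.sum_filter, sum_prism, Finset.sum_filter]
    refine Finset.sum_congr rfl fun i _ => ?_
    have : ∀ b', prodBoolMap α (.mk i b') = .mk j b ↔ α i = j ∧ b' = b := fun b' => Prod.ext_iff
    simp only [this]
    cases b <;> simp
  ext ⟨j, _ | _⟩
  · refine (key j false).trans (Eq.trans ?_ (prismMass_false _ _ _).symm)
    rw [← sum_lowerMass_fiber y hc]
    rfl
  · refine (key j true).trans (Eq.trans ?_ (prismMass_true _ _ _).symm)
    rw [← sum_lowerMass_fiber y hc, stdSimplex_map_apply, ← Finset.sum_sub_distrib]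
    rfl

/-- The inclusion of one of the ends of `[n] × [1]`. -/
def prodBoolIncl (n : ℕ) (b : Bool) : Fin (n + 1) →o Prism n :=
  ⟨fun i => (i, b), fun _ _ h => ⟨h, le_rfl⟩⟩

lemma prodBoolIncl_injective (n : ℕ) (b : Bool) : Function.Injective (prodBoolIncl n b) :=
  fun _ _ h => congrArg Prod.fst h

lemma lowerMass_zero (x : stdSimplex ℝ (Fin (n + 1))) (i : Fin (n + 1)) :
    lowerMass x 0 i = 0 := by
  have h : ∀ S : Finset (Fin (n + 1)), 0 ≤ ∑ k ∈ S, x k := fun S =>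
    Finset.sum_nonneg fun k _ => stdSimplex.zero_le x k
  rw [lowerMass, min_eq_left (h _), min_eq_left (h _), sub_zero]

lemma lowerMass_one (x : stdSimplex ℝ (Fin (n + 1))) (i : Fin (n + 1)) :
    lowerMass x 1 i = x i := by
  have h : ∀ S : Finset (Fin (n + 1)), ∑ k ∈ S, x k ≤ 1 := fun S => by
    rw [← stdSimplex.sum_eq_one x]
    exact Finset.sum_le_sum_of_subset_of_nonneg (Finset.subset_univ _)
      fun k _ _ => stdSimplex.zero_le x k
  rw [lowerMass, min_eq_right (h _), min_eq_right (h _), sum_Iic_eq]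
  ring

lemma prismMass_zero (x : stdSimplex ℝ (Fin (n + 1))) :
    stdSimplex.map (prodBoolIncl n false) x = prismMass x 0 := by
  refine stdSimplex_map_eq (prodBoolIncl_injective n false) _ _ (fun i => ?_) ?_
  · exact (by simp [lowerMass_one] : x i = prismMass x 0 (.mk i false))
  · rintro ⟨i, _ | _⟩ h
    · exact absurd ⟨i, rfl⟩ h
    · exact (prismMass_true x 0 i).trans (by simp [lowerMass_one])

lemma prismMass_one (x : stdSimplex ℝ (Fin (n + 1))) :
    stdSimplex.map (prodBoolIncl n true) x = prismMass x 1 := by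
  refine stdSimplex_map_eq (prodBoolIncl_injective n true) _ _ (fun i => ?_) ?_
  · exact (by simp [lowerMass_zero] : x i = prismMass x 1 (.mk i true))
  · rintro ⟨i, _ | _⟩ h
    · exact (prismMass_false x 1 i).trans (by simp [lowerMass_zero])
    · exact absurd ⟨i, rfl⟩ h

/-- The first projection of `[n] × [1]`. -/
def prodBoolFst (n : ℕ) : Prism n →o Fin (n + 1) := OrderHom.fst

lemma map_fst_prismMass (x : stdSimplex ℝ (Fin (n + 1))) (s : unitInterval) :
    stdSimplex.map (prodBoolFst n) (prismMass x s) = x := by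
  ext j
  have : ∀ i b, prodBoolFst n (.mk i b) = i := fun _ _ => rfl
  rw [stdSimplex_map_apply, Finset.sum_filter, sum_prism, Finset.sum_eq_single j]
  · simp [this]
  · intro i _ hi
    simp [this, hi]
  · simp

/-- The maximal chains of `[n] × [1]`. -/
def prismChain (j : Fin (n + 1)) : Fin (n + 2) →o Prism n :=
  ⟨fun i => (j.predAbove i, decide (j.castSucc < i)), fun a b hab =>
    ⟨Fin.predAbove_right_monotone j hab, by
      rw [Bool.le_iff_imp]
      simp only [decide_eq_true_eq]
      exact fun h => h.trans_le hab⟩⟩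

/-- The chain `prismChain j` runs along the lower level up to `j`, climbs there, and continues along
the upper level. -/
lemma prismChain_castSucc {i j : Fin (n + 1)} (h : i ≤ j) :
    prismChain j i.castSucc = .mk i false := by
  have : ¬ j.castSucc < i.castSucc := by simpa using h
  exact Prod.ext (Fin.predAbove_castSucc_of_le _ _ h) (decide_eq_false this)

lemma prismChain_succ {i j : Fin (n + 1)} (h : j ≤ i) :
    prismChain j i.succ = .mk i true := by
  have : j.castSucc < i.succ := Fin.castSucc_lt_succ_iff.2 h
  exact Prod.ext (Fin.predAbove_succ_of_le _ _ h) (decide_eq_true this)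

lemma prismChain_injective (j : Fin (n + 1)) : Function.Injective (prismChain j) := by
  intro a b h
  have h1 : j.predAbove a = j.predAbove b := congrArg Prod.fst h
  have h2 : decide (j.castSucc < a) = decide (j.castSucc < b) := congrArg Prod.snd h
  by_cases ha : j.castSucc < a
  · have hb : j.castSucc < b := by simpa [ha] using h2
    rw [Fin.predAbove_of_castSucc_lt _ _ ha, Fin.predAbove_of_castSucc_lt _ _ hb] at h1
    exact Fin.pred_inj.1 h1
  · have hb : ¬ j.castSucc < b := by simpa [ha] using h2
    rw [Fin.predAbove_of_le_castSucc _ _ (not_lt.1 ha),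
      Fin.predAbove_of_le_castSucc _ _ (not_lt.1 hb)] at h1
    exact Fin.castPred_inj.1 h1

/-- The climb happens at the first vertex `j` where the accumulated mass reaches `1 - s`: before `j`
all mass is on the lower level, after `j` all of it is on the upper level. -/
lemma exists_prismChain (x : stdSimplex ℝ (Fin (n + 1))) (s : unitInterval) :
    ∃ j : Fin (n + 1), ∀ l, l ∉ Set.range (prismChain j) → prismMass x s l = 0 := by
  classical
  have hex : ∃ j : Fin (n + 1), 1 - (s : ℝ) ≤ ∑ k ∈ Finset.Iic j, x k := by
    refine ⟨Fin.last n, ?_⟩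
    have : Finset.Iic (Fin.last n) = Finset.univ := by ext i; simp [Fin.le_last]
    rw [this, stdSimplex.sum_eq_one]
    linarith [s.2.1]
  have mono : ∀ S T : Finset (Fin (n + 1)), S ⊆ T → ∑ k ∈ S, x k ≤ ∑ k ∈ T, x k := fun S T h =>
    Finset.sum_le_sum_of_subset_of_nonneg h fun k _ _ => stdSimplex.zero_le x k
  obtain ⟨j, hj, hmin⟩ : ∃ j : Fin (n + 1), 1 - (s : ℝ) ≤ ∑ k ∈ Finset.Iic j, x k ∧
      ∀ i < j, ∑ k ∈ Finset.Iic i, x k < 1 - (s : ℝ) := by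
    obtain ⟨j, hj⟩ := Finset.exists_minimal
      (s := Finset.univ.filter fun j : Fin (n + 1) => 1 - (s : ℝ) ≤ ∑ k ∈ Finset.Iic j, x k)
      (by obtain ⟨j, hj⟩ := hex; exact ⟨j, by simpa using hj⟩)
    refine ⟨j, (Finset.mem_filter.1 hj.1).2, fun i hi => ?_⟩
    by_contra hcon
    have : i ∈ Finset.univ.filter fun j : Fin (n + 1) => 1 - (s : ℝ) ≤ ∑ k ∈ Finset.Iic j, x k := by
      simpa using hcon
    exact absurd (hj.2 this hi.le) (not_le.2 hi)
  refine ⟨j, ?_⟩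
  rintro ⟨i, _ | _⟩ hl
  · have hi : j < i := by
      by_contra hcon
      exact hl ⟨i.castSucc, prismChain_castSucc (not_lt.1 hcon)⟩
    refine (prismMass_false x s i).trans ?_
    rw [lowerMass, min_eq_left, min_eq_left, sub_self]
    · exact hj.trans (mono _ _ fun k hk => by
        rw [Finset.mem_Iio]; exact (Finset.mem_Iic.1 hk).trans_lt hi)
    · exact hj.trans (mono _ _ fun k hk => by
        rw [Finset.mem_Iic]; exact (Finset.mem_Iic.1 hk).trans hi.le)
  · have hi : i < j := by
      by_contra hcon
      exact hl ⟨i.succ, prismChain_succ (not_lt.1 hcon)⟩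
    have := hmin i hi
    refine (prismMass_true x s i).trans ?_
    rw [lowerMass, min_eq_right this.le, min_eq_right, sum_Iic_eq]
    · ring
    · refine (mono _ _ fun k hk => ?_).trans this.le
      rw [Finset.mem_Iic]; exact (Finset.mem_Iio.1 hk).le

lemma isChainMass_prismMass (x : stdSimplex ℝ (Fin (n + 1))) (s : unitInterval) :
    IsChainMass (prismMass x s) := by
  obtain ⟨j, hj⟩ := exists_prismChain x s
  exact ⟨n + 1, prismChain j, _, map_stdSimplexComap (prismChain_injective j) _ hj⟩

end PrismMass

/-! ### Homotopies given by chains of arrows. -/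

section ArrowPoint

variable {D E : Type u} [Category.{u} D] [Category.{u} E] {n : ℕ}

/-- The functor `[n] × [1] ⥤ D` given by a chain of arrows. -/
def prismFunctor (H : Fin (n + 1) ⥤ Arrow D) : Prism n ⥤ D where
  obj
    | (i, false) => (H.obj i).left
    | (i, true) => (H.obj i).right
  map {p q} f := match p, q, f with
    | (_, false), (_, false), f => (H.map (homOfLE (leOfHom f).1)).left
    | (_, false), (j, true), f => (H.map (homOfLE (leOfHom f).1)).left ≫ (H.obj j).hom
    | (_, true), (_, true), f => (H.map (homOfLE (leOfHom f).1)).right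
    | (_, true), (_, false), f => (Prism.not_le (leOfHom f)).elim
  map_id := by
    rintro ⟨i, _ | _⟩
    · exact congrArg (·.left) (H.map_id i)
    · exact congrArg (·.right) (H.map_id i)
  map_comp := by
    rintro ⟨i, _ | _⟩ ⟨j, _ | _⟩ ⟨k, _ | _⟩ f g
    · exact congrArg (·.left) (H.map_comp (homOfLE (leOfHom f).1) (homOfLE (leOfHom g).1))
    · have := congrArg (·.left) (H.map_comp (homOfLE (leOfHom f).1) (homOfLE (leOfHom g).1))
      exact (congrArg (· ≫ (H.obj k).hom) this).trans (Category.assoc _ _ _)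
    · exact (Prism.not_le (leOfHom g)).elim
    · have := congrArg (·.left) (H.map_comp (homOfLE (leOfHom f).1) (homOfLE (leOfHom g).1))
      refine (congrArg (· ≫ (H.obj k).hom) this).trans ?_
      have h2 := (H.map (homOfLE (leOfHom g).1)).w
      dsimp at h2 ⊢
      rw [Category.assoc, Category.assoc, h2]
    · exact (Prism.not_le (leOfHom f)).elim
    · exact (Prism.not_le (leOfHom f)).elim
    · exact (Prism.not_le (leOfHom g)).elim
    · exact congrArg (·.right) (H.map_comp (homOfLE (leOfHom f).1) (homOfLE (leOfHom g).1))

lemma prismFunctor_comp {p : ℕ} (α : Fin (p + 1) →o Fin (n + 1)) (H : Fin (n + 1) ⥤ Arrow D) :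
    (prodBoolMap α).monotone.functor ⋙ prismFunctor H =
      prismFunctor (α.monotone.functor ⋙ H) := by
  refine Functor.hext ?_ ?_
  · rintro ⟨i, _ | _⟩ <;> rfl
  · rintro ⟨i, _ | _⟩ ⟨j, _ | _⟩ f
    · rfl
    · rfl
    · exact (Prism.not_le (leOfHom f)).elim
    · rfl

lemma prismFunctor_mapArrow (H : Fin (n + 1) ⥤ Arrow D) (L : D ⥤ E) :
    prismFunctor H ⋙ L = prismFunctor (H ⋙ L.mapArrow) := by
  refine Functor.hext ?_ ?_
  · rintro ⟨i, _ | _⟩ <;> rfl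
  · rintro ⟨i, _ | _⟩ ⟨j, _ | _⟩ f
    · rfl
    · exact heq_of_eq (L.map_comp _ _)
    · exact (Prism.not_le (leOfHom f)).elim
    · rfl

lemma prismFunctor_left (H : Fin (n + 1) ⥤ Arrow D) :
    (prodBoolIncl n false).monotone.functor ⋙ prismFunctor H = H ⋙ Arrow.leftFunc := rfl

lemma prismFunctor_right (H : Fin (n + 1) ⥤ Arrow D) :
    (prodBoolIncl n true).monotone.functor ⋙ prismFunctor H = H ⋙ Arrow.rightFunc := rfl

/-- The functor that sends an object to its identity. -/
def idArrow (D : Type u) [Category.{u} D] : D ⥤ Arrow D where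
  obj d := Arrow.mk (𝟙 d)
  map f := Arrow.homMk f f

lemma prismFunctor_idArrow (F : Fin (n + 1) ⥤ D) :
    prismFunctor (F ⋙ idArrow D) = (prodBoolFst n).monotone.functor ⋙ F := by
  refine Functor.hext ?_ ?_
  · rintro ⟨i, _ | _⟩ <;> rfl
  · rintro ⟨i, _ | _⟩ ⟨j, _ | _⟩ f
    · rfl
    · exact heq_of_eq (Category.comp_id _)
    · exact (Prism.not_le (leOfHom f)).elim
    · rfl

/-- The map `Δⁿ × [0, 1] → |nerve D|` given by a chain of arrows of `D`. -/
noncomputable def arrowPoint (H : Fin (n + 1) ⥤ Arrow D) :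
    C(stdSimplex ℝ (Fin (n + 1)) × unitInterval, SSet.toTop.obj (nerve D)) where
  toFun q := massPoint (prismFunctor H) (prismMass q.1 q.2) (isChainMass_prismMass q.1 q.2)
  continuous_toFun := continuous_massPoint _ _ continuous_prismMass _ (fun _ => n + 1) prismChain
    prismChain_injective fun q => exists_prismChain q.1 q.2

lemma arrowPoint_zero (H : Fin (n + 1) ⥤ Arrow D) (x : stdSimplex ℝ (Fin (n + 1))) :
    arrowPoint H (x, 0) = nervePoint (H ⋙ Arrow.leftFunc) x :=
  massPoint_eq _ _ (prodBoolIncl n false) x (prismMass_zero x)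

lemma arrowPoint_one (H : Fin (n + 1) ⥤ Arrow D) (x : stdSimplex ℝ (Fin (n + 1))) :
    arrowPoint H (x, 1) = nervePoint (H ⋙ Arrow.rightFunc) x :=
  massPoint_eq _ _ (prodBoolIncl n true) x (prismMass_one x)

lemma arrowPoint_comp {p : ℕ} (α : Fin (p + 1) →o Fin (n + 1)) (H : Fin (n + 1) ⥤ Arrow D)
    (y : stdSimplex ℝ (Fin (p + 1))) (s : unitInterval) :
    arrowPoint (α.monotone.functor ⋙ H) (y, s) = arrowPoint H (stdSimplex.map α y, s) := by
  refine Eq.trans ?_ (massPoint_map (prismFunctor H) (isChainMass_prismMass y s)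
    (prodBoolMap α) (isChainMass_prismMass _ _) (map_prismMass α y s)).symm
  rw [prismFunctor_comp]
  rfl

lemma map_arrowPoint (L : D ⥤ E) (H : Fin (n + 1) ⥤ Arrow D)
    (x : stdSimplex ℝ (Fin (n + 1))) (s : unitInterval) :
    (SSet.toTop.map (nerveMap L)).hom (arrowPoint H (x, s)) =
      arrowPoint (H ⋙ L.mapArrow) (x, s) := by
  refine (map_massPoint _ _ _).trans ?_
  rw [prismFunctor_mapArrow]
  rfl

/-- For identity arrows the prism functor factors through the projection to `[n]`, which sends the
prism mass back to `x`; the homotopy is constant. -/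
lemma arrowPoint_idArrow (F : Fin (n + 1) ⥤ D) (x : stdSimplex ℝ (Fin (n + 1)))
    (s : unitInterval) : arrowPoint (F ⋙ idArrow D) (x, s) = nervePoint F x := by
  obtain ⟨m, α, y, hy⟩ := isChainMass_prismMass x s
  refine (massPoint_eq _ _ α y hy).trans ?_
  rw [prismFunctor_idArrow]
  have e : stdSimplex.map ((prodBoolFst n).comp α) y = x := by
    rw [← map_fst_prismMass x s, ← hy]
    exact (stdSimplex_map_map (by intro _; rfl) _).symm
  have := nervePoint_comp ((prodBoolFst n).comp α) F y
  rw [e] at this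
  exact this

attribute [irreducible] arrowPoint

end ArrowPoint
end DwyerPushout

/-! ### Collages of partial functors. -/

namespace DwyerPushout
open Opposite

/-- A natural transformation, as a functor to the category of arrows. -/
def natTransArrow {J D : Type*} [Category J] [Category D] {F G : J ⥤ D} (η : F ⟶ G) :
    J ⥤ Arrow D where
  obj j := Arrow.mk (η.app j)
  map f := Arrow.homMk (F.map f) (G.map f) (η.naturality f)

section Collage

variable {V A C : Type u} [Category.{u} V] [Category.{u} A] [Category.{u} C]

/-- A functor to `A` that is defined on a cosieve of `V`. -/
structure PartialFunctor (V A : Type u) [Category.{u} V] [Category.{u} A] where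
  /-- the domain of definition -/
  domain : ObjectProperty V
  isCosieve : IsCosieve domain
  /-- the functor on the domain of definition -/
  functor : domain.FullSubcategory ⥤ A

/-- The composition of a partial functor with a functor. -/
def PartialFunctor.comp (R : PartialFunctor V A) (k : A ⥤ C) : PartialFunctor V C where
  domain := R.domain
  isCosieve := R.isCosieve
  functor := R.functor ⋙ k

/-- The collage of a partial functor `R` from `V` to `A`: its objects are those of `A` and of `V`,
and a morphism from `a : A` to `v : V` is a morphism `a ⟶ R v` (for `v` in the domain of `R`). -/
inductive Collage (R : PartialFunctor V A) : Type u
  | inl (a : A) : Collage R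
  | inr (v : V) : Collage R

namespace Collage

variable (R : PartialFunctor V A)

/-- The morphisms of the collage. -/
def Hom : Collage R → Collage R → Type u
  | inl a, inl a' => a ⟶ a'
  | inl a, inr v => Σ' hv : R.domain v, a ⟶ R.functor.obj ⟨v, hv⟩
  | inr _, inl _ => PEmpty
  | inr v, inr v' => v ⟶ v'

/-- The identities of the collage. -/
def id : ∀ x : Collage R, Hom R x x
  | inl a => 𝟙 a
  | inr v => 𝟙 v

variable {R}

/-- The composition of the collage. -/
def comp : ∀ {x y z : Collage R}, Hom R x y → Hom R y z → Hom R x z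
  | inl _, inl _, inl _, f, g => CategoryStruct.comp (obj := A) f g
  | inl _, inl _, inr _, f, g => ⟨g.1, CategoryStruct.comp (obj := A) f g.2⟩
  | inl _, inr _, inr _, f, g =>
      ⟨R.isCosieve g f.1, f.2 ≫ R.functor.map (ObjectProperty.homMk g)⟩
  | inr _, inr _, inr _, f, g => CategoryStruct.comp (obj := V) f g
  | _, inr _, inl _, _, g => g.elim
  | inr _, inl _, _, f, _ => f.elim

lemma cross_ext {a : A} {v : V} {f g : Hom R (inl a) (inr v)} (h : f.2 = g.2) : f = g := by
  obtain ⟨h₁, f⟩ := f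
  obtain ⟨h₂, g⟩ := g
  exact congrArg (PSigma.mk h₁) h

instance : Category.{u} (Collage R) where
  Hom := Hom R
  id := id R
  comp := comp
  id_comp := by
    rintro (a | v) (a' | v') f
    · exact Category.id_comp (obj := A) f
    · exact cross_ext (Category.id_comp (obj := A) f.2)
    · exact f.elim
    · exact Category.id_comp (obj := V) f
  comp_id := by
    rintro (a | v) (a' | v') f
    · exact Category.comp_id (obj := A) f
    · refine cross_ext ?_
      change f.2 ≫ R.functor.map (𝟙 _) = f.2
      rw [R.functor.map_id, Category.comp_id]
    · exact f.elim
    · exact Category.comp_id (obj := V) f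
  assoc := by
    rintro (a | v) (a' | v') (a'' | v'') (a''' | v''') f g h
    · exact Category.assoc (obj := A) f g h
    · exact cross_ext (Category.assoc (obj := A) f g h.2)
    · exact h.elim
    · exact cross_ext (Category.assoc (obj := A) f g.2 _)
    · exact g.elim
    · exact g.elim
    · exact h.elim
    · refine cross_ext ?_
      change (f.2 ≫ R.functor.map _) ≫ R.functor.map _ = f.2 ≫ R.functor.map _
      rw [Category.assoc, ← R.functor.map_comp]
      rfl
    · exact f.elim
    · exact f.elim
    · exact f.elim
    · exact f.elim
    · exact g.elim
    · exact g.elim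
    · exact h.elim
    · exact Category.assoc (obj := V) f g h

variable (R)

/-- The inclusion of `A` in the collage. -/
def inclA : A ⥤ Collage R where
  obj := inl
  map f := f

/-- The inclusion of `V` in the collage. -/
def inclV : V ⥤ Collage R where
  obj := inr
  map f := f

instance : (inclA R).Full := ⟨fun f => ⟨f, rfl⟩⟩
instance : (inclA R).Faithful := ⟨fun h => h⟩
instance : (inclV R).Full := ⟨fun f => ⟨f, rfl⟩⟩
instance : (inclV R).Faithful := ⟨fun h => h⟩

lemma inclA_injective : Function.Injective (inclA R).obj := fun _ _ h => inl.inj h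

lemma inclV_injective : Function.Injective (inclV R).obj := fun _ _ h => inr.inj h

variable {R}

/-- The morphism of the collage from `a : A` to `v : V` given by a morphism `a ⟶ R v`. -/
def cross {a : A} {v : V} (hv : R.domain v) (f : a ⟶ R.functor.obj ⟨v, hv⟩) :
    (inclA R).obj a ⟶ (inclV R).obj v := ⟨hv, f⟩

lemma map_cross {a a' : A} {v : V} (hv : R.domain v) (g : a' ⟶ a)
    (f : a ⟶ R.functor.obj ⟨v, hv⟩) :
    (inclA R).map g ≫ cross hv f = cross hv (g ≫ f) := rfl

lemma cross_map {a : A} {v v' : V} (hv : R.domain v) (f : a ⟶ R.functor.obj ⟨v, hv⟩)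
    (g : v ⟶ v') :
    cross hv f ≫ (inclV R).map g =
      cross (R.isCosieve g hv) (f ≫ R.functor.map (ObjectProperty.homMk g)) := rfl

/-- The functor between collages given by a functor `A ⥤ C`. -/
def map (R : PartialFunctor V A) (k : A ⥤ C) : Collage R ⥤ Collage (R.comp k) where
  obj
    | inl a => inl (k.obj a)
    | inr v => inr v
  map {x y} f := match x, y, f with
    | inl _, inl _, f => k.map f
    | inl _, inr _, f => ⟨f.1, k.map f.2⟩
    | inr _, inl _, f => f.elim
    | inr _, inr _, f => f
  map_id := by
    rintro (a | v)
    · exact k.map_id a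
    · rfl
  map_comp := by
    rintro (a | v) (a' | v') (a'' | v'') f g
    · exact k.map_comp f g
    · exact cross_ext (k.map_comp f g.2)
    · exact g.elim
    · exact cross_ext (k.map_comp f.2 _)
    · exact f.elim
    · exact f.elim
    · exact g.elim
    · rfl

variable (R)

/-- The objects of the collage that come from `A` or from the domain of `R`. -/
def nearA : ObjectProperty (Collage R)
  | inl _ => True
  | inr v => R.domain v

/-- The objects of the collage that come from the domain of `R`. -/
def inDomain : ObjectProperty (Collage R)
  | inl _ => False
  | inr v => R.domain v

/-- The objects of the collage that come from `V`. -/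
def inV : ObjectProperty (Collage R)
  | inl _ => False
  | inr _ => True

variable {R}

lemma inDomain_le_nearA : inDomain R ≤ nearA R := by
  rintro (a | v) h
  · trivial
  · exact h

/-- Morphisms from `A` reach only the domain of `R`. Hence a chain that starts in `A` stays in
`nearA`, where the coreflection is available. -/
lemma nearA_of_not_inV {x y : Collage R} (f : x ⟶ y) (hx : ¬ inV R x) : nearA R y := by
  cases x with
  | inr v => exact absurd trivial hx
  | inl a =>
    cases y with
    | inl a' => trivial
    | inr v => exact f.1

lemma inV_of_hom {x y : Collage R} (f : x ⟶ y) (hx : inV R x) : inV R y := by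
  cases x with
  | inl a => exact hx.elim
  | inr v =>
    cases y with
    | inl a' => exact f.elim
    | inr v => trivial

lemma inDomain_of {x : Collage R} (h : inV R x) (h' : nearA R x) : inDomain R x := by
  cases x with
  | inl a => exact h.elim
  | inr v => exact h'

lemma inV_map_iff (k : A ⥤ C) (x : Collage R) : inV (R.comp k) ((map R k).obj x) ↔ inV R x := by
  cases x <;> rfl

lemma nearA_map_iff (k : A ⥤ C) (x : Collage R) :
    nearA (R.comp k) ((map R k).obj x) ↔ nearA R x := by
  cases x <;> rfl

lemma inDomain_map_iff (k : A ⥤ C) (x : Collage R) :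
    inDomain (R.comp k) ((map R k).obj x) ↔ inDomain R x := by
  cases x <;> rfl

variable (R)

/-- The retraction of the full subcategory `nearA` onto `A`. -/
def retract : (nearA R).FullSubcategory ⥤ A where
  obj
    | ⟨inl a, _⟩ => a
    | ⟨inr v, hv⟩ => R.functor.obj ⟨v, hv⟩
  map {x y} f := match x, y, f with
    | ⟨inl _, _⟩, ⟨inl _, _⟩, f => f.hom
    | ⟨inl _, _⟩, ⟨inr _, _⟩, f => f.hom.2
    | ⟨inr _, _⟩, ⟨inl _, _⟩, f => f.hom.elim
    | ⟨inr _, _⟩, ⟨inr _, _⟩, f => R.functor.map (ObjectProperty.homMk f.hom)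
  map_id := by
    rintro ⟨a | v, h⟩
    · rfl
    · exact R.functor.map_id _
  map_comp := by
    rintro ⟨a | v, h⟩ ⟨a' | v', h'⟩ ⟨a'' | v'', h''⟩ f g
    · rfl
    · rfl
    · exact g.hom.elim
    · rfl
    · exact f.hom.elim
    · exact f.hom.elim
    · exact g.hom.elim
    · exact R.functor.map_comp (X := ⟨v, h⟩) (Y := ⟨v', h'⟩) (Z := ⟨v'', h''⟩)
        (ObjectProperty.homMk f.hom) (ObjectProperty.homMk g.hom)

/-- The counit of the coreflection of `nearA` onto `A`. -/
def counit : ∀ x : (nearA R).FullSubcategory, (inclA R).obj ((retract R).obj x) ⟶ x.obj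
  | ⟨inl a, _⟩ => 𝟙 ((inclA R).obj a)
  | ⟨inr _, hv⟩ => cross hv (𝟙 _)

/-- The counit of the coreflection of `nearA` onto `A`, as a natural transformation. -/
def counitNatTrans : retract R ⋙ inclA R ⟶ (nearA R).ι where
  app := counit R
  naturality x y f := by
    obtain ⟨a | v, h⟩ := x <;> obtain ⟨a' | v', h'⟩ := y
    · exact (Category.comp_id (obj := A) f.hom).trans (Category.id_comp (obj := A) f.hom).symm
    · refine cross_ext (f := (inclA R).map ((retract R).map f) ≫ counit R ⟨inr v', h'⟩) ?_
      exact (Category.comp_id (obj := A) f.hom.2).trans (Category.id_comp (obj := A) f.hom.2).symm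
    · exact f.hom.elim
    · refine cross_ext (f := (inclA R).map ((retract R).map f) ≫ counit R ⟨inr v', h'⟩) ?_
      exact (Category.comp_id (obj := A) _).trans (Category.id_comp (obj := A) _).symm

/-- The counit of the coreflection of `nearA` onto `A`, as a functor to the category of arrows. -/
def counitArrow : (nearA R).FullSubcategory ⥤ Arrow (Collage R) :=
  natTransArrow (counitNatTrans R)

/-- The inclusion of the domain of `R` in `nearA`. -/
def domainNearA : R.domain.FullSubcategory ⥤ (nearA R).FullSubcategory :=
  (nearA R).lift (R.domain.ι ⋙ inclV R) fun x => x.property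

/-- The identification of `inDomain` with the domain of `R`. -/
def toDomain : (inDomain R).FullSubcategory ⥤ R.domain.FullSubcategory where
  obj
    | ⟨inl _, h⟩ => h.elim
    | ⟨inr v, hv⟩ => ⟨v, hv⟩
  map {x y} f := match x, y, f with
    | ⟨inl _, h⟩, _, _ => h.elim
    | ⟨inr _, _⟩, ⟨inl _, h⟩, _ => h.elim
    | ⟨inr _, _⟩, ⟨inr _, _⟩, f => ObjectProperty.homMk f.hom
  map_id := by
    rintro ⟨a | v, h⟩
    · exact h.elim
    · rfl
  map_comp := by
    rintro ⟨a | v, h⟩ ⟨a' | v', h'⟩ ⟨a'' | v'', h''⟩ f g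
    all_goals first | exact h.elim | exact h'.elim | exact h''.elim | rfl

/-- The identification of `inV` with `V`. -/
def toV : (inV R).FullSubcategory ⥤ V where
  obj
    | ⟨inl _, h⟩ => h.elim
    | ⟨inr v, _⟩ => v
  map {x y} f := match x, y, f with
    | ⟨inl _, h⟩, _, _ => h.elim
    | ⟨inr _, _⟩, ⟨inl _, h⟩, _ => h.elim
    | ⟨inr _, _⟩, ⟨inr _, _⟩, f => f.hom
  map_id := by
    rintro ⟨a | v, h⟩
    · exact h.elim
    · rfl
  map_comp := by
    rintro ⟨a | v, h⟩ ⟨a' | v', h'⟩ ⟨a'' | v'', h''⟩ f g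
    all_goals first | exact h.elim | exact h'.elim | exact h''.elim | rfl

lemma toV_inclV : toV R ⋙ inclV R = (inV R).ι := by
  refine Functor.hext ?_ ?_
  · rintro ⟨a | v, h⟩
    · exact h.elim
    · rfl
  · rintro ⟨a | v, h⟩ ⟨a' | v', h'⟩ f
    all_goals first | exact h.elim | exact h'.elim | rfl

lemma toDomain_domainNearA :
    toDomain R ⋙ domainNearA R = ObjectProperty.ιOfLE inDomain_le_nearA := by
  refine Functor.hext ?_ ?_
  · rintro ⟨a | v, h⟩
    · exact h.elim
    · rfl
  · rintro ⟨a | v, h⟩ ⟨a' | v', h'⟩ f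
    all_goals first | exact h.elim | exact h'.elim | rfl

variable (k : A ⥤ C)

/-- The functor induced by `map R k` on `nearA`. -/
def mapNearA : (nearA R).FullSubcategory ⥤ (nearA (R.comp k)).FullSubcategory :=
  (nearA (R.comp k)).lift ((nearA R).ι ⋙ map R k) fun x => (nearA_map_iff k x.obj).2 x.property

/-- The functor induced by `map R k` on `inDomain`. -/
def mapInDomain : (inDomain R).FullSubcategory ⥤ (inDomain (R.comp k)).FullSubcategory :=
  (inDomain (R.comp k)).lift ((inDomain R).ι ⋙ map R k)
    fun x => (inDomain_map_iff k x.obj).2 x.property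

/-- The functor induced by `map R k` on `inV`. -/
def mapInV : (inV R).FullSubcategory ⥤ (inV (R.comp k)).FullSubcategory :=
  (inV (R.comp k)).lift ((inV R).ι ⋙ map R k) fun x => (inV_map_iff k x.obj).2 x.property

lemma mapNearA_retract : mapNearA R k ⋙ retract (R.comp k) = retract R ⋙ k := by
  refine Functor.hext ?_ ?_
  · rintro ⟨a | v, h⟩ <;> rfl
  · rintro ⟨a | v, h⟩ ⟨a' | v', h'⟩ f
    · rfl
    · rfl
    · exact f.hom.elim
    · rfl

lemma mapInV_toV : mapInV R k ⋙ toV (R.comp k) = toV R := by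
  refine Functor.hext ?_ ?_
  · rintro ⟨a | v, h⟩
    · exact h.elim
    · rfl
  · rintro ⟨a | v, h⟩ ⟨a' | v', h'⟩ f
    all_goals first | exact h.elim | exact h'.elim | rfl

lemma mapInDomain_toDomain : mapInDomain R k ⋙ toDomain (R.comp k) = toDomain R := by
  refine Functor.hext ?_ ?_
  · rintro ⟨a | v, h⟩
    · exact h.elim
    · rfl
  · rintro ⟨a | v, h⟩ ⟨a' | v', h'⟩ f
    all_goals first | exact h.elim | exact h'.elim | rfl

/-- The counit of the coreflection of the collage of `R` over the domain of `R`. -/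
def domainArrow : (inDomain (R.comp k)).FullSubcategory ⥤ Arrow (Collage R) :=
  toDomain (R.comp k) ⋙ domainNearA R ⋙ counitArrow R

/-- The counit `k (R v) ⟶ v` in the collage of `R.comp k` is the image of the counit `R v ⟶ v` in
the collage of `R`. This lets the upper half of the deformation lift to `Collage R`. -/
lemma domainNearA_counitArrow_mapArrow :
    domainNearA R ⋙ counitArrow R ⋙ (map R k).mapArrow =
      domainNearA (R.comp k) ⋙ counitArrow (R.comp k) := by
  have key : Functor.whiskerRight (Functor.whiskerLeft (domainNearA R) (counitNatTrans R))
      (map R k) = Functor.whiskerLeft (domainNearA (R.comp k)) (counitNatTrans (R.comp k)) := by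
    ext x
    exact cross_ext (k.map_id _)
  exact congrArg natTransArrow key

lemma domainArrow_mapArrow :
    domainArrow R k ⋙ (map R k).mapArrow =
      ObjectProperty.ιOfLE inDomain_le_nearA ⋙ counitArrow (R.comp k) := by
  rw [← toDomain_domainNearA]
  exact congrArg (toDomain (R.comp k) ⋙ ·) (domainNearA_counitArrow_mapArrow R k)

lemma mapInDomain_domainArrow :
    mapInDomain R k ⋙ domainArrow R k =
      ObjectProperty.ιOfLE inDomain_le_nearA ⋙ counitArrow R := by
  rw [← toDomain_domainNearA, ← mapInDomain_toDomain R k]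
  rfl

lemma inDomain_retract :
    ObjectProperty.ιOfLE inDomain_le_nearA ⋙ retract R = toDomain R ⋙ R.functor := by
  rw [← toDomain_domainNearA]
  rfl

lemma toDomain_eq_toV :
    toDomain R ⋙ R.domain.ι =
      (inV R).lift (inDomain R).ι (fun x => by
        obtain ⟨a | v, h⟩ := x
        · exact h.elim
        · trivial) ⋙ toV R := by
  refine Functor.hext ?_ ?_
  · rintro ⟨a | v, h⟩
    · exact h.elim
    · rfl
  · rintro ⟨a | v, h⟩ ⟨a' | v', h'⟩ f
    all_goals first | exact h.elim | exact h'.elim | rfl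

end Collage
end Collage
end DwyerPushout

/-! ### Path spaces, and maps out of realized nerves. -/

namespace DwyerPushout

section Paths

/-- The space of paths of a space. -/
def pathSpace (T : TopCat.{u}) : TopCat.{u} := TopCat.of C(unitInterval, T)

/-- A family of maps to the path space, from a continuous map on the product with the interval. -/
def pathCurry {X : Type*} [TopologicalSpace X] {T : TopCat.{u}} (F : C(X × unitInterval, T)) :
    C(X, pathSpace T) := F.curry

/-- Evaluation of paths. -/
def pathEval {T : TopCat.{u}} (γ : pathSpace T) (s : unitInterval) : T :=
  (show C(unitInterval, T) from γ) s

lemma pathSpace_ext {T : TopCat.{u}} {γ γ' : pathSpace T} (h : ∀ s, pathEval γ s = pathEval γ' s) :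
    γ = γ' := ContinuousMap.ext h

/-- Postcomposition of paths with a continuous map. -/
def pathMap {T T' : TopCat.{u}} (f : T ⟶ T') : pathSpace T ⟶ pathSpace T' :=
  TopCat.ofHom ⟨fun γ => f.hom.comp γ, ContinuousMap.continuous_postcomp f.hom⟩

/-- Constant paths. -/
def pathConst (T : TopCat.{u}) : T ⟶ pathSpace T :=
  TopCat.ofHom ⟨fun t => ContinuousMap.const _ t, ContinuousMap.continuous_const'⟩

/-- Homotopies are treated as maps into the path space, so that they can be defined on realizations
and pushouts by the universal property alone. -/
lemma homotopic_of_path {X T : TopCat.{u}} (F : X ⟶ pathSpace T) (f g : C(X, T))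
    (h0 : ∀ x, pathEval (F.hom x) 0 = f x) (h1 : ∀ x, pathEval (F.hom x) 1 = g x) :
    f.Homotopic g := by
  let F' : C(X, C(unitInterval, T)) := F.hom
  exact ⟨{ toFun := fun p => F'.uncurry (p.2, p.1)
           continuous_toFun := F'.uncurry.continuous.comp continuous_swap
           map_zero_left := h0
           map_one_left := h1 }⟩

end Paths

section NerveFamily

variable {D : Type u} [Category.{u} D] {T : TopCat.{u}}

/-- A compatible family of continuous maps defined on the simplices of the nerve of a category. -/
structure NerveFamily (D : Type u) [Category.{u} D] (T : TopCat.{u}) where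
  /-- the map on each simplex -/
  toFun : ∀ {n : ℕ}, (Fin (n + 1) ⥤ D) → C(stdSimplex ℝ (Fin (n + 1)), T)
  naturality : ∀ {n p : ℕ} (α : Fin (p + 1) →o Fin (n + 1)) (F : Fin (n + 1) ⥤ D)
    (y : stdSimplex ℝ (Fin (p + 1))),
    toFun (α.monotone.functor ⋙ F) y = toFun F (stdSimplex.map α y)

/-- The map from the realization of the nerve given by a compatible family. -/
noncomputable def NerveFamily.desc (F : NerveFamily D T) : SSet.toTop.obj (nerve D) ⟶ T :=
  SimplexFamily.desc (X := nerve D)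
    { toFun := fun σ => F.toFun σ
      naturality := fun α σ y => F.naturality α.toOrderHom σ y }

lemma NerveFamily.desc_nervePoint (F : NerveFamily D T) {n : ℕ} (σ : Fin (n + 1) ⥤ D)
    (x : stdSimplex ℝ (Fin (n + 1))) : F.desc.hom (nervePoint σ x) = F.toFun σ x := by
  rw [nervePoint_eq]
  exact SimplexFamily.desc_simplexPoint (X := nerve D) _ _ _

lemma nerve_hom_ext {f g : SSet.toTop.obj (nerve D) ⟶ T}
    (h : ∀ (n : ℕ) (σ : Fin (n + 1) ⥤ D) (x : stdSimplex ℝ (Fin (n + 1))),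
      f.hom (nervePoint σ x) = g.hom (nervePoint σ x)) : f = g := by
  refine toTop_hom_ext (X := nerve D) fun n σ x => ?_
  have := h n σ x
  have e : nervePoint (D := D) (n := n) σ = simplexPoint (X := nerve D) (n := n) σ :=
    nervePoint_eq σ
  rwa [e] at this

end NerveFamily

/-! ### Moving mass between the head and the tail of a chain. -/

section Reweight

variable {n : ℕ}

/-- The total mass of a set of vertices. -/
noncomputable def tailMass (T : Fin (n + 1) → Prop) (x : stdSimplex ℝ (Fin (n + 1))) : ℝ :=
  open Classical in ∑ i with T i, x i

/-- The factor by which the masses outside of the tail are multiplied. -/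
noncomputable def headFactor (u t : ℝ) : ℝ :=
  -- At `u = 0` this is `(1 - 2t)/(1 - t)` for `t ≤ 1/2` and `0` afterwards; the second `max` keeps
  -- the denominator positive and acts only where the numerator vanishes.
  (1 - u) * (max (1 - 2 * t) 0 / max (1 - t) (1 / 2)) + u

/-- The factor by which the masses of the tail are multiplied. -/
noncomputable def tailFactor (u t : ℝ) : ℝ := (1 - u) * (1 / max t (1 / 2)) + u

/-- Conservation of mass. At `u = 0` the tail is doubled for `t ≤ 1/2` and normalized to total mass
`1` for `t ≥ 1/2`. -/
lemma headFactor_mul_add (u t : ℝ) :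
    headFactor u t * (1 - t) + tailFactor u t * t = 1 := by
  unfold headFactor tailFactor
  rcases le_total t (1 / 2) with h | h
  · rw [max_eq_left (by linarith : (0 : ℝ) ≤ 1 - 2 * t),
      max_eq_left (by linarith : (1 / 2 : ℝ) ≤ 1 - t), max_eq_right h]
    have : (1 - t) ≠ 0 := by linarith
    field_simp
    ring
  · rw [max_eq_right (by linarith : 1 - 2 * t ≤ (0 : ℝ)), max_eq_left h]
    have : t ≠ 0 := by linarith
    field_simp
    ring

lemma headFactor_nonneg {u : ℝ} (hu : 0 ≤ u) (hu' : u ≤ 1) (t : ℝ) : 0 ≤ headFactor u t := by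
  unfold headFactor
  have h1 : (0 : ℝ) ≤ max (1 - 2 * t) 0 := le_max_right _ _
  have h2 : (0 : ℝ) < max (1 - t) (1 / 2) := lt_of_lt_of_le (by norm_num) (le_max_right _ _)
  have := mul_nonneg (sub_nonneg.2 hu') (div_nonneg h1 h2.le)
  linarith

lemma tailFactor_nonneg {u : ℝ} (hu : 0 ≤ u) (hu' : u ≤ 1) (t : ℝ) : 0 ≤ tailFactor u t := by
  unfold tailFactor
  have h2 : (0 : ℝ) < max t (1 / 2) := lt_of_lt_of_le (by norm_num) (le_max_right _ _)
  have := mul_nonneg (sub_nonneg.2 hu') (div_nonneg zero_le_one h2.le)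
  linarith

lemma continuous_headFactor : Continuous fun p : ℝ × ℝ => headFactor p.1 p.2 := by
  unfold headFactor
  have h2 : ∀ p : ℝ × ℝ, max (1 - p.2) (1 / 2) ≠ 0 := fun p =>
    (lt_of_lt_of_le (by norm_num) (le_max_right _ _)).ne'
  fun_prop (disch := exact h2)

lemma continuous_tailFactor : Continuous fun p : ℝ × ℝ => tailFactor p.1 p.2 := by
  unfold tailFactor
  have h2 : ∀ p : ℝ × ℝ, max p.2 (1 / 2) ≠ 0 := fun p =>
    (lt_of_lt_of_le (by norm_num) (le_max_right _ _)).ne'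
  fun_prop (disch := exact h2)

variable (T : Fin (n + 1) → Prop)

lemma sum_not_tail (x : stdSimplex ℝ (Fin (n + 1))) :
    open Classical in ∑ i with ¬ T i, x i = 1 - tailMass T x := by
  classical
  rw [eq_sub_iff_add_eq, ← stdSimplex.sum_eq_one x, add_comm]
  unfold tailMass
  convert Finset.sum_filter_add_sum_filter_not Finset.univ T (fun i => x i)

lemma continuous_tailMass : Continuous (tailMass T) :=
  continuous_finsetSum _ fun i _ => (continuous_apply i).comp continuous_subtype_val

/-- The point of the simplex obtained by multiplying the masses in the tail by a common factor, and
the other masses by a common factor. -/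
noncomputable def reweight (u : unitInterval) (x : stdSimplex ℝ (Fin (n + 1))) :
    stdSimplex ℝ (Fin (n + 1)) :=
  open Classical in
  ⟨fun i => (if T i then tailFactor u (tailMass T x) else headFactor u (tailMass T x)) * x i, by
    classical
    refine ⟨fun i => mul_nonneg ?_ (stdSimplex.zero_le x i), ?_⟩
    · split_ifs
      · exact tailFactor_nonneg u.2.1 u.2.2 _
      · exact headFactor_nonneg u.2.1 u.2.2 _
    · rw [← Finset.sum_filter_add_sum_filter_not Finset.univ T, ← headFactor_mul_add u
        (tailMass T x), add_comm]
      congr 1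
      · rw [← sum_not_tail, Finset.mul_sum]
        exact Finset.sum_congr rfl fun i hi => by rw [if_neg (Finset.mem_filter.1 hi).2]
      · rw [tailMass, Finset.mul_sum]
        exact Finset.sum_congr rfl fun i hi => by rw [if_pos (Finset.mem_filter.1 hi).2]⟩

lemma reweight_apply_tail (u : unitInterval) (x : stdSimplex ℝ (Fin (n + 1))) {i : Fin (n + 1)}
    (hi : T i) : reweight T u x i = tailFactor u (tailMass T x) * x i := by
  classical
  exact congrArg (· * x i) (if_pos hi)

lemma reweight_apply_head (u : unitInterval) (x : stdSimplex ℝ (Fin (n + 1))) {i : Fin (n + 1)}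
    (hi : ¬ T i) : reweight T u x i = headFactor u (tailMass T x) * x i := by
  classical
  exact congrArg (· * x i) (if_neg hi)

lemma continuous_reweight :
    Continuous fun p : stdSimplex ℝ (Fin (n + 1)) × unitInterval => reweight T p.2 p.1 := by
  classical
  refine Continuous.subtype_mk (continuous_pi fun i => ?_) _
  have hx : Continuous fun p : stdSimplex ℝ (Fin (n + 1)) × unitInterval => p.1 i :=
    (continuous_apply i).comp (continuous_subtype_val.comp continuous_fst)
  have hut : Continuous fun p : stdSimplex ℝ (Fin (n + 1)) × unitInterval =>
      ((p.2 : ℝ), tailMass T p.1) :=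
    (continuous_subtype_val.comp continuous_snd).prodMk
      ((continuous_tailMass T).comp continuous_fst)
  refine Continuous.mul ?_ hx
  split_ifs
  · exact continuous_tailFactor.comp hut
  · exact continuous_headFactor.comp hut

lemma tailMass_map {p : ℕ} (α : Fin (p + 1) → Fin (n + 1)) (y : stdSimplex ℝ (Fin (p + 1))) :
    tailMass T (stdSimplex.map α y) = tailMass (fun i => T (α i)) y := by
  classical
  unfold tailMass
  simp only [stdSimplex_map_apply]
  rw [Finset.sum_filter, Finset.sum_filter,
    ← Finset.sum_fiberwise Finset.univ α (fun i => if T (α i) then y i else 0)]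
  refine Finset.sum_congr rfl fun k _ => ?_
  split_ifs with hk
  · refine Finset.sum_congr rfl fun i hi => ?_
    rw [if_pos (by rw [(Finset.mem_filter.1 hi).2]; exact hk)]
  · symm
    refine Finset.sum_eq_zero fun i hi => ?_
    rw [if_neg (by rw [(Finset.mem_filter.1 hi).2]; exact hk)]

lemma reweight_map {p : ℕ} (α : Fin (p + 1) → Fin (n + 1)) (u : unitInterval)
    (y : stdSimplex ℝ (Fin (p + 1))) :
    reweight T u (stdSimplex.map α y) = stdSimplex.map α (reweight (fun i => T (α i)) u y) := by
  classical
  ext j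
  by_cases hj : T j
  · rw [reweight_apply_tail T u _ hj, tailMass_map, stdSimplex_map_apply, stdSimplex_map_apply,
      Finset.mul_sum]
    refine Finset.sum_congr rfl fun i hi => ?_
    rw [reweight_apply_tail]
    rw [(Finset.mem_filter.1 hi).2]; exact hj
  · rw [reweight_apply_head T u _ hj, tailMass_map, stdSimplex_map_apply, stdSimplex_map_apply,
      Finset.mul_sum]
    refine Finset.sum_congr rfl fun i hi => ?_
    rw [reweight_apply_head]
    rw [(Finset.mem_filter.1 hi).2]; exact hj

lemma reweight_one (x : stdSimplex ℝ (Fin (n + 1))) : reweight T 1 x = x := by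
  ext i
  by_cases hi : T i
  · rw [reweight_apply_tail T _ _ hi]
    simp [tailFactor]
  · rw [reweight_apply_head T _ _ hi]
    simp [headFactor]

lemma reweight_of_tailMass_eq_zero (u : unitInterval) {x : stdSimplex ℝ (Fin (n + 1))}
    (h : tailMass T x = 0) : reweight T u x = x := by
  classical
  ext i
  by_cases hi : T i
  · have := (Finset.sum_eq_zero_iff_of_nonneg (fun i _ => stdSimplex.zero_le x i)).1 h i
      (by simpa using hi)
    rw [reweight_apply_tail T _ _ hi, this, mul_zero]
  · rw [reweight_apply_head T _ _ hi, h]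
    norm_num [headFactor]

lemma eq_zero_of_tailMass_eq_one {x : stdSimplex ℝ (Fin (n + 1))} (h : tailMass T x = 1)
    {i : Fin (n + 1)} (hi : ¬ T i) : x i = 0 := by
  classical
  have e := sum_not_tail T x
  rw [h, sub_self] at e
  exact (Finset.sum_eq_zero_iff_of_nonneg (fun i _ => stdSimplex.zero_le x i)).1 e i
    (by simpa using hi)

lemma reweight_of_tailMass_eq_one (u : unitInterval) {x : stdSimplex ℝ (Fin (n + 1))}
    (h : tailMass T x = 1) : reweight T u x = x := by
  ext i
  by_cases hi : T i
  · rw [reweight_apply_tail T _ _ hi, h]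
    norm_num [tailFactor]
  · rw [reweight_apply_head T _ _ hi, eq_zero_of_tailMass_eq_one T h hi, mul_zero]

lemma reweight_zero_apply_head {x : stdSimplex ℝ (Fin (n + 1))} (h : 1 / 2 ≤ tailMass T x)
    {i : Fin (n + 1)} (hi : ¬ T i) : reweight T 0 x i = 0 := by
  rw [reweight_apply_head T _ _ hi]
  have : headFactor (0 : unitInterval) (tailMass T x) = 0 := by
    rw [headFactor, max_eq_right (by linarith : 1 - 2 * tailMass T x ≤ 0)]
    simp
  rw [this, zero_mul]

/-- The height over a point with tail mass `t`. -/
noncomputable def height (u : unitInterval) (t : ℝ) : unitInterval :=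
  -- At `u = 0` the height is `0` up to `t = 1/2` and then grows linearly to `1` at `t = 1`; at `u =
  -- 1` it is always `1`.
  ⟨(1 - u) * min (max (2 * t - 1) 0) 1 + u, by
    have h0 : 0 ≤ min (max (2 * t - 1) 0) 1 := le_min (le_max_right _ _) zero_le_one
    have h1 : min (max (2 * t - 1) 0) 1 ≤ 1 := min_le_right _ _
    have hu := u.2.1
    have hu' := sub_nonneg.2 u.2.2
    constructor
    · have := mul_nonneg hu' h0
      linarith
    · have := mul_le_mul_of_nonneg_left h1 hu'
      linarith⟩

lemma continuous_height : Continuous fun p : ℝ × unitInterval => height p.2 p.1 := by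
  refine Continuous.subtype_mk ?_ _
  fun_prop

lemma height_one (t : ℝ) : height 1 t = 1 := by
  ext
  simp [height]

lemma height_zero {t : ℝ} (h : t ≤ 1 / 2) : height 0 t = 0 := by
  ext
  simp [height, max_eq_right (by linarith : 2 * t - 1 ≤ 0)]

lemma height_of_one (u : unitInterval) : height u 1 = 1 := by
  ext
  norm_num [height]

end Reweight
end DwyerPushout

/-! ### The deformation of a realized collage. -/

namespace DwyerPushout
open Collage

section Shift

variable {n : ℕ}

/-- The map `[n] → [n]` that sends `i` to `max i m`. -/
def shift (m : Fin (n + 1)) : Fin (n + 1) →o Fin (n + 1) :=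
  ⟨fun i => max i m, fun _ _ h => max_le_max_right m h⟩

lemma shift_apply_of_le {m i : Fin (n + 1)} (h : m ≤ i) : shift m i = i := max_eq_left h

lemma le_shift (m i : Fin (n + 1)) : m ≤ shift m i := le_max_right i m

lemma map_shift {m : Fin (n + 1)} {x : stdSimplex ℝ (Fin (n + 1))} (h : ∀ i, i < m → x i = 0) :
    stdSimplex.map (shift m) x = x := by
  classical
  ext j
  rw [stdSimplex_map_apply, Finset.sum_filter, Finset.sum_eq_single j]
  · split_ifs with hj
    · rfl
    · by_contra hne
      refine hj (shift_apply_of_le (not_lt.1 fun hlt => hne (h j hlt).symm))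
  · intro i _ hi
    split_ifs with hij
    · by_contra hne
      refine hi ((shift_apply_of_le (not_lt.1 fun hlt => hne (h i hlt))).symm.trans hij)
    · rfl
  · simp

lemma monotone_functor_comp_eq {D : Type*} [Category D] {p q : ℕ}
    {α β : Fin (p + 1) →o Fin (q + 1)} (h : ∀ i, α i = β i) (F : Fin (q + 1) ⥤ D) :
    α.monotone.functor ⋙ F = β.monotone.functor ⋙ F := by
  obtain rfl : α = β := OrderHom.ext _ _ (funext h)
  rfl

variable {D : Type u} [Category.{u} D]

/-- A point without mass before `m` sees only the part of the chain from `m` on. Precomposing with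
`shift m` expresses this restriction without changing the number of vertices. -/
lemma nervePoint_eq_of_shift {F G : Fin (n + 1) ⥤ D} {m : Fin (n + 1)}
    {x : stdSimplex ℝ (Fin (n + 1))} (hx : ∀ i, i < m → x i = 0)
    (h : (shift m).monotone.functor ⋙ F = (shift m).monotone.functor ⋙ G) :
    nervePoint F x = nervePoint G x := by
  rw [← map_shift hx, ← nervePoint_comp, ← nervePoint_comp, h]

lemma arrowPoint_eq_of_shift {F G : Fin (n + 1) ⥤ Arrow D} {m : Fin (n + 1)}
    {x : stdSimplex ℝ (Fin (n + 1))} (hx : ∀ i, i < m → x i = 0) (s : unitInterval)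
    (h : (shift m).monotone.functor ⋙ F = (shift m).monotone.functor ⋙ G) :
    arrowPoint F (x, s) = arrowPoint G (x, s) := by
  rw [← map_shift hx, ← arrowPoint_comp, ← arrowPoint_comp, h]

end Shift

section

variable {V A C : Type u} [Category.{u} V] [Category.{u} A] [Category.{u} C]
variable {R : PartialFunctor V A} {n : ℕ}

/-- The vertices of a chain in the collage that come from `V`. -/
def tail (σ : Fin (n + 1) ⥤ Collage R) (i : Fin (n + 1)) : Prop := inV R (σ.obj i)

lemma tail_mono (σ : Fin (n + 1) ⥤ Collage R) {i j : Fin (n + 1)} (h : i ≤ j) (hi : tail σ i) :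
    tail σ j := inV_of_hom (σ.map (homOfLE h)) hi

lemma nearA_of_not_tail (σ : Fin (n + 1) ⥤ Collage R) (h : ¬ tail σ 0) (i : Fin (n + 1)) :
    nearA R (σ.obj i) := nearA_of_not_inV (σ.map (homOfLE (Fin.zero_le i))) h

/-- A chain that starts in `A`, as a chain in `nearA`. -/
def nearLift (σ : Fin (n + 1) ⥤ Collage R) (h : ¬ tail σ 0) :
    Fin (n + 1) ⥤ (nearA R).FullSubcategory :=
  (nearA R).lift σ (nearA_of_not_tail σ h)

lemma tailMass_eq_one_of_tail {σ : Fin (n + 1) ⥤ Collage R} (h : tail σ 0)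
    (x : stdSimplex ℝ (Fin (n + 1))) : tailMass (tail σ) x = 1 := by
  classical
  rw [← stdSimplex.sum_eq_one x]
  refine Finset.sum_congr ?_ fun _ _ => rfl
  ext i
  simpa using tail_mono σ (Fin.zero_le i) h

lemma tailMass_comp {p : ℕ} (α : Fin (p + 1) →o Fin (n + 1)) (σ : Fin (n + 1) ⥤ Collage R)
    (y : stdSimplex ℝ (Fin (p + 1))) :
    tailMass (tail (α.monotone.functor ⋙ σ)) y = tailMass (tail σ) (stdSimplex.map α y) :=
  (tailMass_map (tail σ) α y).symm

lemma reweight_comp {p : ℕ} (α : Fin (p + 1) →o Fin (n + 1)) (σ : Fin (n + 1) ⥤ Collage R)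
    (u : unitInterval) (y : stdSimplex ℝ (Fin (p + 1))) :
    stdSimplex.map α (reweight (tail (α.monotone.functor ⋙ σ)) u y) =
      reweight (tail σ) u (stdSimplex.map α y) :=
  (reweight_map (tail σ) α u y).symm

/-- The deformation of the realization of the nerve of a collage, on a simplex. -/
noncomputable def deformSimplex (σ : Fin (n + 1) ⥤ Collage R) :
    C(stdSimplex ℝ (Fin (n + 1)) × unitInterval, SSet.toTop.obj (nerve (Collage R))) :=
  open Classical in
  -- A chain in `V` does not move. Any other chain lies in `nearA`, and its points move in the prism
  -- of the counit.
  if h : tail σ 0 then (nervePoint σ).comp ContinuousMap.fst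
  else (arrowPoint (nearLift σ h ⋙ counitArrow R)).comp
    ⟨fun p => (reweight (tail σ) p.2 p.1, height p.2 (tailMass (tail σ) p.1)),
      (continuous_reweight _).prodMk (continuous_height.comp
        (((continuous_tailMass _).comp continuous_fst).prodMk continuous_snd))⟩

lemma deformSimplex_of_tail {σ : Fin (n + 1) ⥤ Collage R} (h : tail σ 0)
    (x : stdSimplex ℝ (Fin (n + 1))) (u : unitInterval) :
    deformSimplex σ (x, u) = nervePoint σ x := by
  rw [deformSimplex, dif_pos h]
  rfl

lemma deformSimplex_of_not_tail {σ : Fin (n + 1) ⥤ Collage R} (h : ¬ tail σ 0)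
    (x : stdSimplex ℝ (Fin (n + 1))) (u : unitInterval) :
    deformSimplex σ (x, u) = arrowPoint (nearLift σ h ⋙ counitArrow R)
      (reweight (tail σ) u x, height u (tailMass (tail σ) x)) := by
  rw [deformSimplex, dif_neg h]
  rfl

/-- The two formulas meet when `α` drops the whole head. The tail mass is then `1`, so nothing is
reweighted and the height is `1`, where the counit arrow ends at the original chain. -/
lemma deformSimplex_comp {p : ℕ} (α : Fin (p + 1) →o Fin (n + 1)) (σ : Fin (n + 1) ⥤ Collage R)
    (y : stdSimplex ℝ (Fin (p + 1))) (u : unitInterval) :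
    deformSimplex (α.monotone.functor ⋙ σ) (y, u) = deformSimplex σ (stdSimplex.map α y, u) := by
  by_cases h : tail σ 0
  · have h' : tail (α.monotone.functor ⋙ σ) 0 := tail_mono σ (Fin.zero_le _) h
    rw [deformSimplex_of_tail h, deformSimplex_of_tail h', nervePoint_comp]
  · rw [deformSimplex_of_not_tail h]
    by_cases h' : tail (α.monotone.functor ⋙ σ) 0
    · have e : tailMass (tail σ) (stdSimplex.map α y) = 1 := by
        rw [← tailMass_comp, tailMass_eq_one_of_tail h']
      rw [deformSimplex_of_tail h', e, height_of_one, reweight_of_tailMass_eq_one _ _ e,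
        arrowPoint_one, nervePoint_comp]
      rfl
    · rw [deformSimplex_of_not_tail h', ← reweight_comp, tailMass_comp, ← arrowPoint_comp]
      rfl

variable (R) in
/-- The deformation of the realization of the nerve of a collage. -/
noncomputable def deform :
    SSet.toTop.obj (nerve (Collage R)) ⟶ pathSpace (SSet.toTop.obj (nerve (Collage R))) :=
  NerveFamily.desc
    { toFun := fun σ => pathCurry (deformSimplex σ)
      naturality := fun α σ y => pathSpace_ext fun u => deformSimplex_comp α σ y u }

lemma deform_nervePoint (σ : Fin (n + 1) ⥤ Collage R) (x : stdSimplex ℝ (Fin (n + 1)))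
    (u : unitInterval) : pathEval ((deform R).hom (nervePoint σ x)) u = deformSimplex σ (x, u) := by
  rw [deform, NerveFamily.desc_nervePoint]
  rfl

lemma deformSimplex_one (σ : Fin (n + 1) ⥤ Collage R) (x : stdSimplex ℝ (Fin (n + 1))) :
    deformSimplex σ (x, 1) = nervePoint σ x := by
  by_cases h : tail σ 0
  · rw [deformSimplex_of_tail h]
  · rw [deformSimplex_of_not_tail h, reweight_one, height_one, arrowPoint_one]
    rfl

lemma not_tail_inclA (F : Fin (n + 1) ⥤ A) (i : Fin (n + 1)) : ¬ tail (F ⋙ inclA R) i := fun h => h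

lemma tailMass_eq_zero {T : Fin (n + 1) → Prop} (h : ∀ i, ¬ T i) (x : stdSimplex ℝ (Fin (n + 1))) :
    tailMass T x = 0 := by
  classical
  refine Finset.sum_eq_zero fun i hi => ?_
  exact absurd (Finset.mem_filter.1 hi).2 (h i)

/-- There is no tail mass to reweight, and the counit on `A` is the identity. -/
lemma deformSimplex_inclA (F : Fin (n + 1) ⥤ A) (x : stdSimplex ℝ (Fin (n + 1)))
    (u : unitInterval) : deformSimplex (F ⋙ inclA R) (x, u) = nervePoint (F ⋙ inclA R) x := by
  have e := tailMass_eq_zero (not_tail_inclA (R := R) F) x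
  rw [deformSimplex_of_not_tail (not_tail_inclA F 0), reweight_of_tailMass_eq_zero _ _ e]
  exact arrowPoint_idArrow (F ⋙ inclA R) x _

/-! ### The homotopy inverse. -/

section Inverse

variable (R) (k : A ⥤ C) {Z : TopCat.{u}}
  (b : SSet.toTop.obj (nerve (Collage R)) ⟶ Z) (c : SSet.toTop.obj (nerve C) ⟶ Z)

/-- `m` is the first vertex of the tail. -/
def IsTailStart (T : Fin (n + 1) → Prop) (m : Fin (n + 1)) : Prop := ∀ i, m ≤ i ↔ T i

lemma exists_isTailStart {T : Fin (n + 1) → Prop} (hT : ∀ i j, i ≤ j → T i → T j)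
    (h : ∃ i, T i) : ∃ m, IsTailStart T m := by
  classical
  obtain ⟨m, hm⟩ := Finset.exists_minimal (s := Finset.univ.filter T)
    (by obtain ⟨i, hi⟩ := h; exact ⟨i, by simpa using hi⟩)
  have hm1 : T m := by simpa using hm.1
  refine ⟨m, fun i => ⟨fun hi => hT m i hi hm1, fun hi => ?_⟩⟩
  rcases le_total m i with h | h
  · exact h
  · exact hm.2 (by simpa using hi) h

variable {R k}

lemma inDomain_shift {σ : Fin (n + 1) ⥤ Collage R} (h : ¬ tail σ 0) {m : Fin (n + 1)}
    (hm : IsTailStart (tail σ) m) (i : Fin (n + 1)) :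
    inDomain R (((shift m).monotone.functor ⋙ σ).obj i) :=
  inDomain_of ((hm _).1 (le_shift m i)) (nearA_of_not_tail σ h _)

/-- The arrows in the collage of `R` given by the tail of a chain in the collage of `R.comp k`. -/
def tailArrow {σ : Fin (n + 1) ⥤ Collage (R.comp k)} (h : ¬ tail σ 0) {m : Fin (n + 1)}
    (hm : IsTailStart (tail σ) m) : Fin (n + 1) ⥤ Arrow (Collage R) :=
  (inDomain (R.comp k)).lift ((shift m).monotone.functor ⋙ σ) (inDomain_shift h hm) ⋙
    domainArrow R k

lemma lift_congr {J D : Type*} [Category J] [Category D] {P : ObjectProperty D} {F G : J ⥤ D}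
    (h : F = G) (hF : ∀ j, P (F.obj j)) (hG : ∀ j, P (G.obj j)) : P.lift F hF = P.lift G hG := by
  subst h
  rfl

/-- The inverse on the part of a simplex with tail mass at most `1 / 2`. -/
noncomputable def inverseLow (σ : Fin (n + 1) ⥤ Collage (R.comp k)) (h : ¬ tail σ 0)
    (x : stdSimplex ℝ (Fin (n + 1))) : Z :=
  c.hom (nervePoint (nearLift σ h ⋙ retract (R.comp k)) (reweight (tail σ) 0 x))

/-- The inverse on the part of a simplex with tail mass at least `1 / 2`. -/
noncomputable def inverseHigh {σ : Fin (n + 1) ⥤ Collage (R.comp k)} (h : ¬ tail σ 0)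
    {m : Fin (n + 1)} (hm : IsTailStart (tail σ) m) (x : stdSimplex ℝ (Fin (n + 1))) : Z :=
  b.hom (arrowPoint (tailArrow h hm)
    (reweight (tail σ) 0 x, height 0 (tailMass (tail σ) x)))

lemma continuous_reweight_zero (T : Fin (n + 1) → Prop) : Continuous (reweight T 0) :=
  (continuous_reweight T).comp (Continuous.prodMk_left (0 : unitInterval))

lemma continuous_inverseLow (σ : Fin (n + 1) ⥤ Collage (R.comp k)) (h : ¬ tail σ 0) :
    Continuous (inverseLow c σ h) :=
  c.hom.continuous.comp ((nervePoint _).continuous.comp (continuous_reweight_zero _))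

lemma continuous_inverseHigh {σ : Fin (n + 1) ⥤ Collage (R.comp k)} (h : ¬ tail σ 0)
    {m : Fin (n + 1)} (hm : IsTailStart (tail σ) m) : Continuous (inverseHigh b h hm) :=
  b.hom.continuous.comp ((arrowPoint _).continuous.comp
    ((continuous_reweight_zero _).prodMk (continuous_height.comp
      ((continuous_tailMass _).prodMk continuous_const))))

lemma reweight_zero_lt {σ : Fin (n + 1) ⥤ Collage R} {m : Fin (n + 1)}
    (hm : IsTailStart (tail σ) m) {x : stdSimplex ℝ (Fin (n + 1))}
    (hx : 1 / 2 ≤ tailMass (tail σ) x) (i : Fin (n + 1)) (hi : i < m) :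
    reweight (tail σ) 0 x i = 0 :=
  reweight_zero_apply_head _ hx fun h => absurd ((hm i).2 h) (not_le.2 hi)

lemma shift_comp_eq {D : Type*} [Category D] (m : Fin (n + 1)) (F : Fin (n + 1) ⥤ D) :
    (shift m).monotone.functor ⋙ (shift m).monotone.functor ⋙ F =
      (shift m).monotone.functor ⋙ F :=
  monotone_functor_comp_eq (α := (shift m).comp (shift m)) (β := shift m)
    (fun i => shift_apply_of_le (le_shift m i)) F

lemma shift_tailArrow {σ : Fin (n + 1) ⥤ Collage (R.comp k)} (h : ¬ tail σ 0) {m : Fin (n + 1)}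
    (hm : IsTailStart (tail σ) m) :
    (shift m).monotone.functor ⋙ tailArrow h hm = tailArrow h hm := by
  refine congrArg (· ⋙ domainArrow R k) (lift_congr (P := inDomain (R.comp k))
    (F := (shift m).monotone.functor ⋙ (shift m).monotone.functor ⋙ σ) ?_
    (fun i => inDomain_shift h hm (shift m i)) (inDomain_shift h hm))
  exact shift_comp_eq m σ

/-- At `t = 1/2` the head is empty and the height is `0`. The upper formula gives the left end of
the counit arrows, the chain `R v` over the tail; it lies in `A`, where `b` and `c` agree by `hbc`.
-/
lemma inverseLow_eq_inverseHigh
    (hbc : ∀ {n : ℕ} (F : Fin (n + 1) ⥤ A) (x : stdSimplex ℝ (Fin (n + 1))),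
      b.hom (nervePoint (F ⋙ inclA R) x) = c.hom (nervePoint (F ⋙ k) x))
    {σ : Fin (n + 1) ⥤ Collage (R.comp k)} (h : ¬ tail σ 0)
    {m : Fin (n + 1)} (hm : IsTailStart (tail σ) m) {x : stdSimplex ℝ (Fin (n + 1))}
    (hx : tailMass (tail σ) x = 1 / 2) :
    inverseLow c σ h x = inverseHigh b h hm x := by
  rw [inverseLow, inverseHigh, height_zero hx.le, arrowPoint_zero]
  have e : tailArrow h hm ⋙ Arrow.leftFunc =
      ((inDomain (R.comp k)).lift ((shift m).monotone.functor ⋙ σ) (inDomain_shift h hm) ⋙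
        toDomain (R.comp k) ⋙ R.functor) ⋙ inclA R := rfl
  rw [e, hbc]
  congr 1
  refine nervePoint_eq_of_shift (m := m) (reweight_zero_lt hm hx.ge) ?_
  have e1 : (inDomain (R.comp k)).lift ((shift m).monotone.functor ⋙ σ) (inDomain_shift h hm) ⋙
        (toDomain (R.comp k) ⋙ (R.comp k).functor) =
      (shift m).monotone.functor ⋙ nearLift σ h ⋙ retract (R.comp k) := by
    rw [← inDomain_retract]
    rfl
  have e2 := congrArg ((shift m).monotone.functor ⋙ ·) e1
  refine Eq.trans ?_ e2.symm
  exact (shift_comp_eq m (nearLift σ h ⋙ retract (R.comp k))).symm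

end Inverse

end
end DwyerPushout

namespace DwyerPushout
open Collage

section

variable {V A C : Type u} [Category.{u} V] [Category.{u} A] [Category.{u} C]
variable {R : PartialFunctor V A} {k : A ⥤ C} {n : ℕ} {Z : TopCat.{u}}
  (b : SSet.toTop.obj (nerve (Collage R)) ⟶ Z) (c : SSet.toTop.obj (nerve C) ⟶ Z)

/-- A chain in the collage that starts in `V`, as a chain in `V`. -/
def vLift (σ : Fin (n + 1) ⥤ Collage R) (h : tail σ 0) : Fin (n + 1) ⥤ V :=
  (inV R).lift σ (fun i => tail_mono σ (Fin.zero_le i) h) ⋙ toV R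

lemma vLift_inclV (σ : Fin (n + 1) ⥤ Collage R) (h : tail σ 0) : vLift σ h ⋙ inclV R = σ :=
  congrArg ((inV R).lift σ (fun i => tail_mono σ (Fin.zero_le i) h) ⋙ ·) (toV_inclV R)

lemma IsTailStart.unique {T : Fin (n + 1) → Prop} {m m' : Fin (n + 1)} (h : IsTailStart T m)
    (h' : IsTailStart T m') : m = m' :=
  le_antisymm ((h _).2 ((h' _).1 le_rfl)) ((h' _).2 ((h _).1 le_rfl))

lemma exists_isTailStart_of_tailMass {σ : Fin (n + 1) ⥤ Collage R}
    {x : stdSimplex ℝ (Fin (n + 1))} (h : 1 / 2 ≤ tailMass (tail σ) x) :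
    ∃ m, IsTailStart (tail σ) m := by
  refine exists_isTailStart (fun i j => tail_mono σ) ?_
  by_contra! hn
  rw [tailMass_eq_zero hn] at h
  norm_num at h

/-- The homotopy inverse, as a function on a simplex. -/
noncomputable def inverseFun (σ : Fin (n + 1) ⥤ Collage (R.comp k))
    (x : stdSimplex ℝ (Fin (n + 1))) : Z :=
  open Classical in
  if h : tail σ 0 then b.hom (nervePoint (vLift σ h ⋙ inclV R) x)
  else if hm : ∃ m, IsTailStart (tail σ) m then
    if tailMass (tail σ) x ≤ 1 / 2 then inverseLow c σ h x
    else inverseHigh b h hm.choose_spec x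
  -- A chain without tail has tail mass `0`, so the lower formula applies.
  else inverseLow c σ h x

lemma inverseFun_of_tail {σ : Fin (n + 1) ⥤ Collage (R.comp k)} (h : tail σ 0)
    (x : stdSimplex ℝ (Fin (n + 1))) :
    inverseFun b c σ x = b.hom (nervePoint (vLift σ h ⋙ inclV R) x) :=
  dif_pos h

lemma inverseFun_low {σ : Fin (n + 1) ⥤ Collage (R.comp k)} (h : ¬ tail σ 0)
    {x : stdSimplex ℝ (Fin (n + 1))} (hx : tailMass (tail σ) x ≤ 1 / 2) :
    inverseFun b c σ x = inverseLow c σ h x := by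
  rw [inverseFun, dif_neg h]
  split_ifs <;> rfl

variable (hbc : ∀ {n : ℕ} (F : Fin (n + 1) ⥤ A) (x : stdSimplex ℝ (Fin (n + 1))),
  b.hom (nervePoint (F ⋙ inclA R) x) = c.hom (nervePoint (F ⋙ k) x))

include hbc

lemma inverseFun_high {σ : Fin (n + 1) ⥤ Collage (R.comp k)} (h : ¬ tail σ 0)
    {m : Fin (n + 1)} (hm : IsTailStart (tail σ) m)
    {x : stdSimplex ℝ (Fin (n + 1))} (hx : 1 / 2 ≤ tailMass (tail σ) x) :
    inverseFun b c σ x = inverseHigh b h hm x := by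
  have hex : ∃ m, IsTailStart (tail σ) m := ⟨m, hm⟩
  rcases hx.eq_or_lt with e | hlt
  · rw [inverseFun_low b c h e.symm.le, inverseLow_eq_inverseHigh b c hbc h hm e.symm]
  · rw [inverseFun, dif_neg h, dif_pos hex, if_neg (not_le.2 hlt)]
    obtain rfl := hm.unique hex.choose_spec
    rfl

lemma continuous_inverseFun (σ : Fin (n + 1) ⥤ Collage (R.comp k)) :
    Continuous (inverseFun b c σ) := by
  by_cases h : tail σ 0
  · exact (b.hom.continuous.comp (nervePoint _).continuous).congr
      fun x => (inverseFun_of_tail b c h x).symm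
  · by_cases hm : ∃ m, IsTailStart (tail σ) m
    · obtain ⟨m, hm⟩ := hm
      refine (Continuous.if_le (f' := inverseLow c σ h) (g' := inverseHigh b h hm)
        (continuous_inverseLow c σ h) (continuous_inverseHigh b h hm)
        (continuous_tailMass (tail σ)) (continuous_const (y := (1 / 2 : ℝ)))
        fun x hx => inverseLow_eq_inverseHigh b c hbc h hm hx).congr fun x => ?_
      split_ifs with hx
      · exact (inverseFun_low b c h hx).symm
      · exact (inverseFun_high b c hbc h hm (not_le.1 hx).le).symm
    · refine (continuous_inverseLow c σ h).congr fun x => (inverseFun_low b c h ?_).symm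
      by_contra hx
      exact hm (exists_isTailStart_of_tailMass (not_le.1 hx).le)

/-- As for the deformation, the case of a face inside `V` rests on the tail mass being `1`. In the
upper half, the tails of the chain and of its face may start at vertices `m` and `m'` that do not
correspond, so both are restricted to the tail of the face. -/
lemma inverseFun_comp {p : ℕ} (α : Fin (p + 1) →o Fin (n + 1))
    (σ : Fin (n + 1) ⥤ Collage (R.comp k)) (y : stdSimplex ℝ (Fin (p + 1))) :
    inverseFun b c (α.monotone.functor ⋙ σ) y = inverseFun b c σ (stdSimplex.map α y) := by
  by_cases h : tail σ 0
  · have h' : tail (α.monotone.functor ⋙ σ) 0 := tail_mono σ (Fin.zero_le _) h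
    rw [inverseFun_of_tail b c h, inverseFun_of_tail b c h', ← nervePoint_comp]
    rfl
  · by_cases h' : tail (α.monotone.functor ⋙ σ) 0
    · have e : tailMass (tail σ) (stdSimplex.map α y) = 1 := by
        rw [← tailMass_comp, tailMass_eq_one_of_tail h']
      obtain ⟨m, hm⟩ := exists_isTailStart_of_tailMass (σ := σ) (x := stdSimplex.map α y)
        (by rw [e]; norm_num)
      rw [inverseFun_high b c hbc h hm (by rw [e]; norm_num), inverseFun_of_tail b c h',
        inverseHigh, e, height_of_one, reweight_of_tailMass_eq_one _ _ e, arrowPoint_one,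
        ← nervePoint_comp]
      congr 2
      -- All vertices of the face lie at or after `m`, where `shift m` is the identity.
      have e1 : α.monotone.functor ⋙ (shift m).monotone.functor ⋙ σ = α.monotone.functor ⋙ σ :=
        monotone_functor_comp_eq (α := (shift m).comp α) (β := α)
          (fun i => shift_apply_of_le ((hm _).2 (tail_mono (α.monotone.functor ⋙ σ) (Fin.zero_le i) h'))) σ
      have e2 : tailArrow h hm ⋙ Arrow.rightFunc =
          (inDomain (R.comp k)).lift ((shift m).monotone.functor ⋙ σ) (inDomain_shift h hm) ⋙
            (toDomain (R.comp k) ⋙ (R.comp k).domain.ι) ⋙ inclV R := rfl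
      rw [e2, toDomain_eq_toV]
      refine congrArg (fun (G : Fin (p + 1) ⥤ (inV (R.comp k)).FullSubcategory) =>
        nervePoint ((G ⋙ toV (R.comp k)) ⋙ inclV R)) (lift_congr e1.symm _ (fun i => ?_))
      exact (hm _).1 (le_shift m (α i))
    · rcases le_total (tailMass (tail σ) (stdSimplex.map α y)) (1 / 2) with hx | hx
      · have hx' : tailMass (tail (α.monotone.functor ⋙ σ)) y ≤ 1 / 2 := by rwa [tailMass_comp]
        rw [inverseFun_low b c h hx, inverseFun_low b c h' hx', inverseLow, inverseLow,
          ← reweight_comp, ← nervePoint_comp]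
        rfl
      · have hx' : 1 / 2 ≤ tailMass (tail (α.monotone.functor ⋙ σ)) y := by rwa [tailMass_comp]
        obtain ⟨m, hm⟩ := exists_isTailStart_of_tailMass hx
        obtain ⟨m', hm'⟩ := exists_isTailStart_of_tailMass hx'
        rw [inverseFun_high b c hbc h hm hx, inverseFun_high b c hbc h' hm' hx', inverseHigh,
          inverseHigh, ← reweight_comp, ← arrowPoint_comp, tailMass_comp]
        congr 1
        refine arrowPoint_eq_of_shift (m := m') (reweight_zero_lt hm' hx') _ ?_
        refine congrArg (· ⋙ domainArrow R k) (lift_congr (P := inDomain (R.comp k))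
          (F := (shift m').monotone.functor ⋙ (shift m').monotone.functor ⋙
            α.monotone.functor ⋙ σ)
          (G := (shift m').monotone.functor ⋙ α.monotone.functor ⋙
            (shift m).monotone.functor ⋙ σ) ?_
          (fun i => inDomain_shift h' hm' (shift m' i))
          (fun i => inDomain_shift h hm (α (shift m' i))))
        refine monotone_functor_comp_eq (α := (α.comp (shift m')).comp (shift m'))
          (β := ((shift m).comp α).comp (shift m')) (fun i => ?_) σ
        have e : shift m' (shift m' i) = shift m' i := shift_apply_of_le (le_shift m' i)
        change α (shift m' (shift m' i)) = shift m (α (shift m' i))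
        rw [e]
        exact (shift_apply_of_le ((hm _).2 ((hm' _).1 (le_shift m' i)))).symm

/-- The homotopy inverse. -/
noncomputable def inverse : SSet.toTop.obj (nerve (Collage (R.comp k))) ⟶ Z :=
  NerveFamily.desc
    { toFun := fun σ => ⟨inverseFun b c σ, continuous_inverseFun b c hbc σ⟩
      naturality := fun α σ y => inverseFun_comp b c hbc α σ y }

lemma inverse_nervePoint (σ : Fin (n + 1) ⥤ Collage (R.comp k)) (x : stdSimplex ℝ (Fin (n + 1))) :
    (inverse b c hbc).hom (nervePoint σ x) = inverseFun b c σ x :=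
  NerveFamily.desc_nervePoint _ σ x

omit hbc in
lemma inverseFun_inclA (F : Fin (n + 1) ⥤ C) (x : stdSimplex ℝ (Fin (n + 1))) :
    inverseFun b c (F ⋙ inclA (R.comp k)) x = c.hom (nervePoint F x) := by
  have e := tailMass_eq_zero (not_tail_inclA (R := R.comp k) F) x
  rw [inverseFun_low b c (not_tail_inclA F 0) (by rw [e]; norm_num), inverseLow,
    reweight_of_tailMass_eq_zero _ _ e]
  rfl

/-- On chains from `Collage R` the inverse is the end of the deformation of `Collage R`, pushed to
`Z`. The lower half uses `hbc` to pass from `A` to `C`; the upper half uses that the lifted arrows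
are the counits of `Collage R`. -/
lemma inverseFun_map (σ : Fin (n + 1) ⥤ Collage R) (x : stdSimplex ℝ (Fin (n + 1))) :
    inverseFun b c (σ ⋙ map R k) x = b.hom (deformSimplex σ (x, 0)) := by
  have ht : tail (σ ⋙ map R k) = tail σ := funext fun i => propext (inV_map_iff k (σ.obj i))
  by_cases h : tail σ 0
  · have h' : tail (σ ⋙ map R k) 0 := ht ▸ h
    rw [inverseFun_of_tail b c h', deformSimplex_of_tail h]
    congr 2
    refine congrArg nervePoint (Eq.trans ?_ (vLift_inclV σ h))
    exact congrArg (fun G => (inV R).lift σ (fun i => tail_mono σ (Fin.zero_le i) h) ⋙ G ⋙ inclV R)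
      (mapInV_toV R k)
  · have h' : ¬ tail (σ ⋙ map R k) 0 := ht ▸ h
    rw [deformSimplex_of_not_tail h]
    rcases le_total (tailMass (tail σ) x) (1 / 2) with hx | hx
    · rw [inverseFun_low b c h' (ht ▸ hx), inverseLow, height_zero hx, arrowPoint_zero, ht]
      have e1 : (nearLift σ h ⋙ counitArrow R) ⋙ Arrow.leftFunc =
          (nearLift σ h ⋙ retract R) ⋙ inclA R := rfl
      rw [e1, hbc]
      congr 2
      exact congrArg (fun G => nervePoint (nearLift σ h ⋙ G)) (mapNearA_retract R k)
    · obtain ⟨m, hm⟩ := exists_isTailStart_of_tailMass hx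
      have hm' : IsTailStart (tail (σ ⋙ map R k)) m := ht ▸ hm
      rw [inverseFun_high b c hbc h' hm' (ht ▸ hx), inverseHigh, ht]
      congr 1
      refine arrowPoint_eq_of_shift (m := m) (reweight_zero_lt hm hx) _ ?_
      have e1 : (shift m).monotone.functor ⋙ tailArrow h' hm' = tailArrow h' hm' :=
        shift_tailArrow h' hm'
      refine e1.trans ?_
      exact congrArg ((inDomain R).lift ((shift m).monotone.functor ⋙ σ) (inDomain_shift h hm) ⋙ ·)
        (mapInDomain_domainArrow R k)

/-- The other composite: `g` maps the lifted counits back to those of `Collage (R.comp k)`, so it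
recovers the end of its deformation. -/
lemma map_inverseFun (g : Z ⟶ SSet.toTop.obj (nerve (Collage (R.comp k))))
    (hb : ∀ {n : ℕ} (F : Fin (n + 1) ⥤ Collage R) (x : stdSimplex ℝ (Fin (n + 1))),
      g.hom (b.hom (nervePoint F x)) = nervePoint (F ⋙ map R k) x)
    (hb' : ∀ {n : ℕ} (F : Fin (n + 1) ⥤ Arrow (Collage R)) (x : stdSimplex ℝ (Fin (n + 1)))
      (s : unitInterval),
      g.hom (b.hom (arrowPoint F (x, s))) = arrowPoint (F ⋙ (map R k).mapArrow) (x, s))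
    (hc : ∀ {n : ℕ} (F : Fin (n + 1) ⥤ C) (x : stdSimplex ℝ (Fin (n + 1))),
      g.hom (c.hom (nervePoint F x)) = nervePoint (F ⋙ inclA (R.comp k)) x)
    (σ : Fin (n + 1) ⥤ Collage (R.comp k)) (x : stdSimplex ℝ (Fin (n + 1))) :
    g.hom (inverseFun b c σ x) = deformSimplex σ (x, 0) := by
  by_cases h : tail σ 0
  · rw [inverseFun_of_tail b c h, deformSimplex_of_tail h, hb]
    exact congrArg (fun G => nervePoint G x) (vLift_inclV σ h)
  · rw [deformSimplex_of_not_tail h]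
    rcases le_total (tailMass (tail σ) x) (1 / 2) with hx | hx
    · rw [inverseFun_low b c h hx, inverseLow, height_zero hx, arrowPoint_zero, hc]
      rfl
    · obtain ⟨m, hm⟩ := exists_isTailStart_of_tailMass hx
      rw [inverseFun_high b c hbc h hm hx, inverseHigh, hb']
      refine arrowPoint_eq_of_shift (m := m) (reweight_zero_lt hm hx) _ ?_
      have e1 := shift_tailArrow h hm
      refine (congrArg (· ⋙ (map R k).mapArrow) e1).trans ?_
      exact congrArg ((inDomain (R.comp k)).lift ((shift m).monotone.functor ⋙ σ)
        (inDomain_shift h hm) ⋙ ·) (domainArrow_mapArrow R k)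

end
end DwyerPushout

/-! ### The weak equivalence for a collage square. -/

namespace DwyerPushout
open Collage

/-- Evaluation of paths, as a continuous map. -/
def pathEvalHom (T : TopCat.{u}) (s : unitInterval) : pathSpace T ⟶ T :=
  TopCat.ofHom ⟨fun γ => pathEval γ s,
    continuous_eval_const (F := C(unitInterval, T)) s⟩

section

variable {V A C : Type u} [Category.{u} V] [Category.{u} A] [Category.{u} C]
variable {R : PartialFunctor V A} {k : A ⥤ C}

theorem isWeakEquivalence_collage {P : SSet.{u}} {f : nerve (Collage R) ⟶ P} {g : nerve C ⟶ P}
    (sq : IsPushout (nerveMap (inclA R)) (nerveMap k) f g)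
    (φ : P ⟶ nerve (Collage (R.comp k))) (hf : f ≫ φ = nerveMap (map R k))
    (hg : g ≫ φ = nerveMap (inclA (R.comp k))) : IsWeakEquivalence φ := by
  let b := SSet.toTop.map f
  let c := SSet.toTop.map g
  let r := SSet.toTop.map φ
  have sqT : IsPushout (SSet.toTop.map (nerveMap (inclA R))) (SSet.toTop.map (nerveMap k)) b c :=
    sq.map SSet.toTop
  have hbr : b ≫ r = SSet.toTop.map (nerveMap (map R k)) := by
    rw [← hf, Functor.map_comp]
  have hcr : c ≫ r = SSet.toTop.map (nerveMap (inclA (R.comp k))) := by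
    rw [← hg, Functor.map_comp]
  have hbc : ∀ {n : ℕ} (F : Fin (n + 1) ⥤ A) (x : stdSimplex ℝ (Fin (n + 1))),
      b.hom (nervePoint (F ⋙ inclA R) x) = c.hom (nervePoint (F ⋙ k) x) := by
    intro n F x
    rw [← map_nervePoint, ← map_nervePoint]
    exact ConcreteCategory.congr_hom sqT.w (nervePoint F x)
  have hb : ∀ z, r.hom (b.hom z) = (SSet.toTop.map (nerveMap (map R k))).hom z :=
    fun z => ConcreteCategory.congr_hom hbr z
  have hc : ∀ z, r.hom (c.hom z) = (SSet.toTop.map (nerveMap (inclA (R.comp k)))).hom z :=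
    fun z => ConcreteCategory.congr_hom hcr z
  let s := inverse b c hbc
  have hsb : SSet.toTop.map (nerveMap (map R k)) ≫ s =
      deform R ≫ pathMap b ≫ pathEvalHom _ 0 := by
    refine nerve_hom_ext fun n σ x => ?_
    change s.hom ((SSet.toTop.map (nerveMap (map R k))).hom (nervePoint σ x)) =
      b.hom (pathEval ((deform R).hom (nervePoint σ x)) 0)
    rw [map_nervePoint, inverse_nervePoint, inverseFun_map b c hbc, deform_nervePoint]
  have hsc : SSet.toTop.map (nerveMap (inclA (R.comp k))) ≫ s = c := by
    refine nerve_hom_ext fun n σ x => ?_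
    change s.hom ((SSet.toTop.map (nerveMap (inclA (R.comp k)))).hom (nervePoint σ x)) =
      c.hom (nervePoint σ x)
    rw [map_nervePoint, inverse_nervePoint, inverseFun_inclA]
  have hdefl : SSet.toTop.map (nerveMap (inclA R)) ≫ deform R ≫ pathMap b =
      SSet.toTop.map (nerveMap k) ≫ c ≫ pathConst _ := by
    refine nerve_hom_ext fun n σ x => pathSpace_ext fun u => ?_
    change b.hom (pathEval ((deform R).hom
      ((SSet.toTop.map (nerveMap (inclA R))).hom (nervePoint σ x))) u) =
      c.hom ((SSet.toTop.map (nerveMap k)).hom (nervePoint σ x))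
    rw [map_nervePoint, map_nervePoint, deform_nervePoint, deformSimplex_inclA, hbc]
  -- On the pushout, the deformation of `Collage R` is glued to the constant homotopy on `C`; this
  -- is possible because the deformation fixes `A`.
  let H := sqT.desc (deform R ≫ pathMap b) (c ≫ pathConst _) hdefl
  have hHb : b ≫ H = deform R ≫ pathMap b := sqT.inl_desc _ _ _
  have hHc : c ≫ H = c ≫ pathConst _ := sqT.inr_desc _ _ _
  have hHb' : ∀ z, H.hom (b.hom z) = (pathMap b).hom ((deform R).hom z) :=
    fun z => ConcreteCategory.congr_hom hHb z
  have hHc' : ∀ z, H.hom (c.hom z) = (pathConst _).hom (c.hom z) :=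
    fun z => ConcreteCategory.congr_hom hHc z
  have hev0 : H ≫ pathEvalHom _ 0 = r ≫ s := by
    refine sqT.hom_ext ?_ ?_
    · rw [reassoc_of% hHb, reassoc_of% hbr, hsb]
    · rw [reassoc_of% hHc, reassoc_of% hcr, hsc]
      rfl
  have hev1 : H ≫ pathEvalHom _ 1 = 𝟙 _ := by
    refine sqT.hom_ext ?_ ?_
    · rw [reassoc_of% hHb, Category.comp_id]
      refine nerve_hom_ext fun n σ x => ?_
      change b.hom (pathEval ((deform R).hom (nervePoint σ x)) 1) = b.hom (nervePoint σ x)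
      rw [deform_nervePoint, deformSimplex_one]
    · rw [reassoc_of% hHc, Category.comp_id]
      rfl
  have hgs : s ≫ r = deform (R.comp k) ≫ pathEvalHom _ 0 := by
    refine nerve_hom_ext fun n σ x => ?_
    change r.hom (s.hom (nervePoint σ x)) = pathEval ((deform (R.comp k)).hom (nervePoint σ x)) 0
    rw [deform_nervePoint, inverse_nervePoint]
    refine map_inverseFun b c hbc r (fun F x => ?_) (fun F x s => ?_) (fun F x => ?_) σ x
    · rw [hb, map_nervePoint]
    · rw [hb, map_arrowPoint]
    · rw [hc, map_nervePoint]
  have hid : deform (R.comp k) ≫ pathEvalHom _ 1 = 𝟙 _ := by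
    refine nerve_hom_ext fun n σ x => ?_
    change pathEval ((deform (R.comp k)).hom (nervePoint σ x)) 1 = nervePoint σ x
    rw [deform_nervePoint, deformSimplex_one]
  refine ⟨⟨r.hom, s.hom, ?_, ?_⟩, rfl⟩
  · exact homotopic_of_path H _ _ (fun x => ConcreteCategory.congr_hom hev0 x)
      (fun x => ConcreteCategory.congr_hom hev1 x)
  · exact homotopic_of_path (deform (R.comp k)) _ _
      (fun x => (ConcreteCategory.congr_hom hgs x).symm)
      (fun x => ConcreteCategory.congr_hom hid x)

end
end DwyerPushout

/-! ### Pushouts of collages in small categories. -/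

namespace DwyerPushout
open Collage

section FullyFaithful

lemma exists_lift_of_fullyFaithful {I J D : Type*} [Category I] [Category J] [Category D]
    (L : J ⥤ D) [L.Full] [L.Faithful] (F : I ⥤ D) (h : ∀ i, ∃ x, L.obj x = F.obj i) :
    ∃ G : I ⥤ J, G ⋙ L = F := by
  choose x hx using h
  refine ⟨{ obj := x
            map := fun {i j} f => L.preimage (eqToHom (hx i) ≫ F.map f ≫ eqToHom (hx j).symm)
            map_id := fun i => L.map_injective (by simp)
            map_comp := fun f g => L.map_injective (by simp) }, ?_⟩
  exact CategoryTheory.Functor.ext hx fun i j f => by simp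

lemma eq_of_comp_eq_of_faithful {I J D : Type*} [Category I] [Category J] [Category D]
    {L : J ⥤ D} [L.Faithful] (hL : Function.Injective L.obj) {F G : I ⥤ J}
    (h : F ⋙ L = G ⋙ L) : F = G := by
  refine CategoryTheory.Functor.ext (fun i => hL (Functor.congr_obj h i)) fun i j f =>
    L.map_injective ?_
  have e := Functor.congr_hom h f
  simp only [Functor.comp_map] at e
  simp [e, eqToHom_map]

lemma isIso_toCatHom {J D : Type u} [Category.{u} J] [Category.{u} D] (L : J ⥤ D) [L.Full]
    [L.Faithful] (hL : Function.Bijective L.obj) : IsIso L.toCatHom := by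
  obtain ⟨G, hG⟩ := exists_lift_of_fullyFaithful L (𝟭 D) hL.2
  have hG' : L ⋙ G = 𝟭 J := eq_of_comp_eq_of_faithful hL.1 (congrArg (L ⋙ ·) hG)
  exact ⟨G.toCatHom, congrArg Functor.toCatHom hG', congrArg Functor.toCatHom hG⟩

end FullyFaithful

section CollagePushout

variable {V A C : Type u} [Category.{u} V] [Category.{u} A] [Category.{u} C]
variable {E : Type*} [Category E]

/-- Together with `A` and `V`, the counits `R v ⟶ v` generate the collage, so functors need be
compared only on these. -/
lemma cross_eq {R : PartialFunctor V A} {a : A} {v : V} (hv : R.domain v)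
    (f : a ⟶ R.functor.obj ⟨v, hv⟩) : cross hv f = (inclA R).map f ≫ cross hv (𝟙 _) := by
  rw [map_cross, Category.comp_id]

lemma collage_functor_ext {R : PartialFunctor V A} {F G : Collage R ⥤ E}
    (hA : inclA R ⋙ F = inclA R ⋙ G) (hV : inclV R ⋙ F = inclV R ⋙ G)
    (h : ∀ (v : V) (hv : R.domain v), F.map (cross hv (𝟙 _)) ≍ G.map (cross hv (𝟙 _))) :
    F = G := by
  have hobj : ∀ x, F.obj x = G.obj x := by
    rintro (a | v)
    · exact Functor.congr_obj hA a
    · exact Functor.congr_obj hV v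
  refine Functor.hext hobj ?_
  rintro (a | v) (a' | v') f
  · exact Functor.hcongr_hom hA f
  · obtain ⟨hv, f⟩ := f
    suffices e : F.map (cross hv f) ≍ G.map (cross hv f) from e
    rw [cross_eq, F.map_comp, G.map_comp]
    exact heq_comp (hobj _) (hobj _) (hobj _) (Functor.hcongr_hom hA f) (h v' hv)
  · exact f.elim
  · exact Functor.hcongr_hom hV f

variable {R : PartialFunctor V A} {k : A ⥤ C}

lemma map_map_cross_id {v : V} (hv : R.domain v) :
    (map R k).map (cross hv (𝟙 _)) = cross (R := R.comp k) hv (𝟙 _) :=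
  cross_ext (k.map_id _)

section Desc

variable (F : Collage R ⥤ E) (G : C ⥤ E) (θ : k ⋙ G ⟶ inclA R ⋙ F)

/-- The values of `collageDesc` on the morphisms from `C` to `V`. -/
def collageDescCross {c : C} {v : V} (hv : R.domain v)
    (f : c ⟶ k.obj (R.functor.obj ⟨v, hv⟩)) : G.obj c ⟶ F.obj ((inclV R).obj v) :=
  G.map f ≫ θ.app (R.functor.obj ⟨v, hv⟩) ≫ F.map (cross hv (𝟙 _))

lemma map_collageDescCross {c c' : C} {v : V} (hv : R.domain v) (g : c' ⟶ c)
    (f : c ⟶ k.obj (R.functor.obj ⟨v, hv⟩)) :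
    collageDescCross F G θ hv (g ≫ f) = G.map g ≫ collageDescCross F G θ hv f := by
  rw [collageDescCross, collageDescCross, G.map_comp, Category.assoc]

lemma collageDescCross_map {c : C} {v v' : V} (hv : R.domain v)
    (f : c ⟶ k.obj (R.functor.obj ⟨v, hv⟩)) (g : v ⟶ v') :
    collageDescCross F G θ (R.isCosieve g hv)
        (f ≫ k.map (R.functor.map (ObjectProperty.homMk g))) =
      collageDescCross F G θ hv f ≫ F.map ((inclV R).map g) := by
  have nat := θ.naturality (R.functor.map (ObjectProperty.homMk (P := R.domain)
    (X := ⟨v, hv⟩) (Y := ⟨v', R.isCosieve g hv⟩) g))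
  simp only [Functor.comp_map] at nat
  rw [collageDescCross, collageDescCross, G.map_comp, Category.assoc, Category.assoc,
    Category.assoc, reassoc_of% nat, ← F.map_comp, ← F.map_comp, cross_map, map_cross,
    Category.comp_id, Category.id_comp]

/-- The functor from the collage of `R.comp k` given by functors on the collage of `R` and
on `C`. -/
def collageDesc : Collage (R.comp k) ⥤ E where
  obj
    | .inl c => G.obj c
    | .inr v => F.obj (.inr v)
  map {x y} f := match x, y, f with
    | .inl _, .inl _, f => G.map f
    | .inl _, .inr _, f => collageDescCross F G θ f.1 f.2
    | .inr _, .inl _, f => f.elim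
    | .inr _, .inr _, f => F.map ((inclV R).map f)
  map_id := by
    rintro (c | v)
    · exact G.map_id c
    · exact F.map_id _
  map_comp := by
    rintro (c | v) (c' | v') (c'' | v'') f g
    · exact G.map_comp f g
    · exact map_collageDescCross F G θ g.1 f g.2
    · exact g.elim
    · exact collageDescCross_map F G θ f.1 f.2 g
    · exact f.elim
    · exact f.elim
    · exact g.elim
    · exact F.map_comp ((inclV R).map f) ((inclV R).map g)

end Desc

/-- Only here does the transformation `θ` come from an equality of functors; the functoriality of
`collageDesc` needs no more than its naturality. -/
lemma map_collageDesc (F : Collage R ⥤ E) (G : C ⥤ E) (h : k ⋙ G = inclA R ⋙ F) :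
    map R k ⋙ collageDesc F G (eqToHom h) = F := by
  refine collage_functor_ext h rfl fun v hv => ?_
  change G.map (k.map (𝟙 _)) ≫ (eqToHom h).app _ ≫ F.map (cross hv (𝟙 _)) ≍ _
  rw [k.map_id, G.map_id, eqToHom_app]
  erw [Category.id_comp]
  exact eqToHom_comp_heq _ _

/-- Objects of `V`, morphisms between them and the counits all come from `Collage R` through `map R
k`; the rest comes from `C`. -/
lemma collage_comp_functor_ext {F G : Collage (R.comp k) ⥤ E}
    (hA : inclA (R.comp k) ⋙ F = inclA (R.comp k) ⋙ G) (h : map R k ⋙ F = map R k ⋙ G) :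
    F = G := by
  refine collage_functor_ext hA (congrArg (inclV R ⋙ ·) h) fun v hv => ?_
  have e : ∀ L : Collage (R.comp k) ⥤ E, (map R k ⋙ L).map (cross hv (𝟙 _)) =
      L.map (cross (R := R.comp k) hv (𝟙 _)) :=
    fun L => congrArg L.map (map_map_cross_id (R := R) hv)
  have e2 := Functor.hcongr_hom h (cross hv (𝟙 _))
  rwa [e, e] at e2

lemma isPushout_collage (R : PartialFunctor V A) (k : A ⥤ C) :
    IsPushout (inclA R).toCatHom k.toCatHom (map R k).toCatHom (inclA (R.comp k)).toCatHom := by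
  refine ⟨⟨rfl⟩, ⟨PushoutCocone.IsColimit.mk _
    (fun s => (collageDesc s.inl.toFunctor s.inr.toFunctor
      (eqToHom (congrArg Cat.Hom.toFunctor s.condition).symm)).toCatHom) (fun s => ?_)
    (fun s => rfl) (fun s m hm hm' => ?_)⟩⟩
  · exact Cat.ext (map_collageDesc _ _ (congrArg Cat.Hom.toFunctor s.condition).symm)
  · have e := map_collageDesc _ _ (congrArg Cat.Hom.toFunctor s.condition).symm
    have e1 : map R k ⋙ m.toFunctor = s.inl.toFunctor := congrArg Cat.Hom.toFunctor hm
    have e2 : inclA (R.comp k) ⋙ m.toFunctor = s.inr.toFunctor :=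
      congrArg Cat.Hom.toFunctor hm'
    exact Cat.ext (collage_comp_functor_ext e2 (e1.trans e.symm))

end CollagePushout
end DwyerPushout

namespace DwyerPushout
open Collage

/-! ### Dwyer maps are inclusions in collages. -/

section Dwyer

variable {A B : Type u} [Category.{u} A] [Category.{u} B]

/-- The objects that are not in the image of a functor. -/
def notInImage (i : A ⥤ B) : ObjectProperty B := fun b => ∀ a, i.obj a ≠ b

section

variable (i : A ⥤ B) (W : ObjectProperty B) (hW : IsCosieve W)

/-- The partial functor from the complement of the image of `i` to `A` given by a functor on a
cosieve. -/
def complementPartialFunctor (r : W.FullSubcategory ⥤ A) :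
    PartialFunctor (notInImage i).FullSubcategory A where
  domain v := W v.obj
  isCosieve _ _ f h := hW f.hom h
  functor := W.lift (ObjectProperty.ι _ ⋙ ObjectProperty.ι _) (fun v => v.property) ⋙ r

variable {i W} (hi : ∀ a, W (i.obj a)) {r : W.FullSubcategory ⥤ A} (adj : W.lift i hi ⊣ r)

/-- The morphism of `B` that corresponds to a morphism of the collage. -/
def dwyerCross {a : A} {b : B} (hb : W b) (f : a ⟶ r.obj ⟨b, hb⟩) : i.obj a ⟶ b :=
  ((adj.homEquiv a ⟨b, hb⟩).symm f).hom

lemma map_dwyerCross {a a' : A} {b : B} (hb : W b) (g : a' ⟶ a) (f : a ⟶ r.obj ⟨b, hb⟩) :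
    dwyerCross hi adj hb (g ≫ f) = i.map g ≫ dwyerCross hi adj hb f := by
  rw [dwyerCross, Adjunction.homEquiv_naturality_left_symm]
  rfl

lemma dwyerCross_map {a : A} {b b' : B} (hb : W b) (hb' : W b') (f : a ⟶ r.obj ⟨b, hb⟩)
    (g : b ⟶ b') :
    dwyerCross hi adj hb' (f ≫ r.map (ObjectProperty.homMk g)) = dwyerCross hi adj hb f ≫ g := by
  rw [dwyerCross, Adjunction.homEquiv_naturality_right_symm]
  rfl

/-- This is the adjunction bijection, combined with the fullness of `W` in `B`. -/
lemma dwyerCross_bijective {a : A} {b : B} (hb : W b) :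
    Function.Bijective (dwyerCross hi adj hb (a := a)) := by
  refine ⟨fun f g h => (adj.homEquiv a ⟨b, hb⟩).symm.injective (ObjectProperty.hom_ext _ h),
    fun g => ⟨adj.homEquiv a ⟨b, hb⟩ (ObjectProperty.homMk g), ?_⟩⟩
  rw [dwyerCross, Equiv.symm_apply_apply]
  rfl

/-- The functor from the collage to `B`. -/
def dwyerCollage : Collage (complementPartialFunctor i W hW r) ⥤ B where
  obj
    | .inl a => i.obj a
    | .inr v => v.obj
  map {x y} f := match x, y, f with
    | .inl _, .inl _, f => i.map f
    | .inl _, .inr _, f => dwyerCross hi adj f.1 f.2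
    | .inr _, .inl _, f => f.elim
    | .inr v, .inr v', f => InducedCategory.Hom.hom (show v ⟶ v' from f)
  map_id := by
    rintro (a | v)
    · exact i.map_id a
    · rfl
  map_comp := by
    rintro (c | v) (c' | v') (c'' | v'') f g
    · exact i.map_comp f g
    · exact map_dwyerCross hi adj g.1 f g.2
    · exact g.elim
    · exact dwyerCross_map hi adj f.1 _ f.2 _
    · exact f.elim
    · exact f.elim
    · exact g.elim
    · rfl

lemma dwyerCollage_bijective (hinj : Function.Injective i.obj) :
    Function.Bijective (dwyerCollage hW hi adj).obj := by
  constructor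
  · rintro (a | v) (a' | v') h
    · exact congrArg Collage.inl (hinj h)
    · exact absurd h (v'.property a)
    · exact absurd h.symm (v.property a')
    · exact congrArg Collage.inr (ObjectProperty.FullSubcategory.ext h)
  · intro b
    by_cases h : ∃ a, i.obj a = b
    · obtain ⟨a, ha⟩ := h
      exact ⟨.inl a, ha⟩
    · exact ⟨.inr ⟨b, not_exists.1 h⟩, rfl⟩

lemma dwyerCollage_full [i.Full] (hs : IsSieve i) : (dwyerCollage hW hi adj).Full := by
  constructor
  rintro (a | v) (a' | v') f
  · exact i.map_surjective f
  -- The cosieve condition puts the target in `W`, hence in the domain of the partial functor.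
  · obtain ⟨g, hg⟩ := (dwyerCross_bijective hi adj (hW f (hi a))).2 f
    exact ⟨⟨hW f (hi a), g⟩, hg⟩
  -- The sieve condition would put an object of the complement into the image of `A`.
  · obtain ⟨a, ha, _⟩ := hs f
    exact absurd ha (v.property a)
  · exact ⟨ObjectProperty.homMk f, rfl⟩

lemma dwyerCollage_faithful [i.Faithful] : (dwyerCollage hW hi adj).Faithful := by
  constructor
  rintro (a | v) (a' | v') f g h
  · exact i.map_injective h
  · exact cross_ext ((dwyerCross_bijective hi adj f.1).1 h)
  · exact f.elim
  · exact ObjectProperty.hom_ext _ h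

end

/-- Every Dwyer map is isomorphic to the inclusion in a collage. -/
lemma IsDwyerMap.exists_collage {A B : Cat.{u, u}} {i : A ⟶ B} (h : IsDwyerMap i.toFunctor) :
    ∃ (V : Cat.{u, u}) (R : PartialFunctor V A) (e : Cat.of (Collage R) ≅ B),
      (inclA R).toCatHom ≫ e.hom = i := by
  obtain ⟨W, hi, hW, _⟩ := h.exists_cosieve
  have := h.full
  have := h.faithful
  let adj := Adjunction.ofIsLeftAdjoint (W.lift i.toFunctor hi)
  have := dwyerCollage_full hW hi adj h.isSieve
  have := dwyerCollage_faithful hW hi adj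
  have := isIso_toCatHom _ (dwyerCollage_bijective hW hi adj h.injective_obj)
  refine ⟨Cat.of (notInImage i.toFunctor).FullSubcategory,
    complementPartialFunctor i.toFunctor W hW (W.lift i.toFunctor hi).rightAdjoint, ?_⟩
  exact ⟨@asIso _ _ _ _ (dwyerCollage hW hi adj).toCatHom this, rfl⟩

end Dwyer

/-! ### Functors from a strongly connected category to a collage. -/

section Exp

variable {V A C : Type u} [Category.{u} V] [Category.{u} A] [Category.{u} C]
variable (I : Type u) [Category.{u} I] (R : PartialFunctor V A)

/-- The partial functor between categories of functors given by a partial functor. -/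
def PartialFunctor.exp : PartialFunctor (I ⥤ V) (I ⥤ A) where
  domain G := ∀ i, R.domain (G.obj i)
  isCosieve _ _ τ h i := R.isCosieve (τ.app i) (h i)
  functor :=
    { obj := fun G => R.domain.lift G.obj G.property ⋙ R.functor
      map := fun {G H} τ =>
        { app := fun i => R.functor.map (ObjectProperty.homMk (X := ⟨_, G.property i⟩)
            (Y := ⟨_, H.property i⟩) (τ.hom.app i))
          naturality := fun i j f => by
            simp only [Functor.comp_map, ← R.functor.map_comp]
            exact congrArg (fun f => R.functor.map (ObjectProperty.homMk f))
              (τ.hom.naturality f) }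
      map_id := fun G => by
        ext i
        exact R.functor.map_id _
      map_comp := fun {G H K} τ τ' => by
        ext i
        exact R.functor.map_comp
          (ObjectProperty.homMk (X := ⟨_, G.property i⟩) (Y := ⟨_, H.property i⟩) (τ.hom.app i))
          (ObjectProperty.homMk (Y := ⟨_, K.property i⟩) (τ'.hom.app i)) }

/-- The comparison functor from the collage of a category of functors to functors to the collage. -/
def expCollage : Collage (R.exp I) ⥤ (I ⥤ Collage R) where
  obj
    | .inl F => F ⋙ inclA R
    | .inr G => G ⋙ inclV R
  map {x y} f := match x, y, f with
    | .inl _, .inl _, f => Functor.whiskerRight f (inclA R)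
    | .inl _, .inr _, f =>
      { app := fun i => cross (f.1 i) (f.2.app i)
        naturality := fun i j g => cross_ext (f.2.naturality g) }
    | .inr _, .inl _, f => f.elim
    | .inr _, .inr _, f => Functor.whiskerRight f (inclV R)
  map_id := by
    rintro (F | G) <;> rfl
  map_comp := by
    rintro (c | v) (c' | v') (c'' | v'') f g
    · rfl
    · rfl
    · exact g.elim
    · rfl
    · exact f.elim
    · exact f.elim
    · exact g.elim
    · rfl

instance : (expCollage I R).Faithful := by
  constructor
  rintro (F | G) (F' | G') f g h
  · exact NatTrans.ext (funext fun i =>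
      congrArg (fun τ : F ⋙ inclA R ⟶ F' ⋙ inclA R => τ.app i) h)
  · refine cross_ext (NatTrans.ext (funext fun i => ?_))
    have e : cross (f.1 i) (f.2.app i) = cross (g.1 i) (g.2.app i) :=
      congrArg (fun τ : F ⋙ inclA R ⟶ G' ⋙ inclV R => τ.app i) h
    exact eq_of_heq (PSigma.mk.inj e).2
  · exact f.elim
  · exact NatTrans.ext (funext fun i =>
      congrArg (fun τ : G ⋙ inclV R ⟶ G' ⋙ inclV R => τ.app i) h)

/-- Nonemptiness excludes transformations from a functor into `V` to a functor into `A`: a single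
component would be a morphism from `V` to `A`. -/
instance [Nonempty I] : (expCollage I R).Full := by
  constructor
  rintro (F | G) (F' | G') τ
  · exact ⟨⟨fun i => τ.app i, fun i j f => τ.naturality f⟩, rfl⟩
  · refine ⟨⟨fun i => (τ.app i).1, ⟨fun i => (τ.app i).2, fun i j f => ?_⟩⟩, rfl⟩
    exact eq_of_heq (PSigma.mk.inj (τ.naturality f)).2
  · exact (τ.app (Classical.arbitrary I)).elim
  · exact ⟨⟨fun i => τ.app i, fun i j f => τ.naturality f⟩, rfl⟩

/-- Since `V` is a cosieve, morphisms of `I` out of `i₀` carry membership in `V` from `i₀` to every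
object, and morphisms into `i₀` carry it back. So a functor lies wholly on the side of its value at
`i₀`, and nonemptiness keeps the two sides apart. -/
lemma expCollage_bijective [Nonempty I] (hI : IsStronglyConnected I) :
    Function.Bijective (expCollage I R).obj := by
  have i₀ := Classical.arbitrary I
  constructor
  · rintro (F | G) (F' | G') h
    · exact congrArg Collage.inl (eq_of_comp_eq_of_faithful (inclA_injective R) h)
    · have e : (Collage.inl _ : Collage R) = .inr _ := Functor.congr_obj h i₀
      cases e
    · have e : (Collage.inr _ : Collage R) = .inl _ := Functor.congr_obj h i₀
      cases e
    · exact congrArg Collage.inr (eq_of_comp_eq_of_faithful (inclV_injective R) h)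
  · intro H
    by_cases h : inV R (H.obj i₀)
    · obtain ⟨G, hG⟩ := exists_lift_of_fullyFaithful (inclV R) H fun i => by
        have := inV_of_hom (H.map (hI i₀ i).some) h
        cases hx : H.obj i with
        | inl a => rw [hx] at this; exact this.elim
        | inr v => exact ⟨v, rfl⟩
      exact ⟨.inr G, hG⟩
    · obtain ⟨F, hF⟩ := exists_lift_of_fullyFaithful (inclA R) H fun i => by
        cases hx : H.obj i with
        | inl a => exact ⟨a, rfl⟩
        | inr v =>
          exact absurd (inV_of_hom (H.map (hI i i₀).some) (by rw [hx]; trivial)) h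
      exact ⟨.inl F, hF⟩

lemma map_expCollage (k : A ⥤ C) :
    map (R.exp I) ((Functor.whiskeringRight I A C).obj k) ⋙ expCollage I (R.comp k) =
      expCollage I R ⋙ (Functor.whiskeringRight I _ _).obj (map R k) := by
  refine Functor.hext ?_ ?_
  · rintro (F | G) <;> rfl
  · rintro (F | G) (F' | G') f
    · rfl
    · rfl
    · exact f.elim
    · rfl

end Exp
end DwyerPushout

/-! ### Transport along isomorphisms, and the theorem. -/

namespace DwyerPushout
open Collage

section WeakEquivalence

lemma isWeakEquivalence_of_isIso {X Y : SSet.{u}} (f : X ⟶ Y) [IsIso f] :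
    IsWeakEquivalence f :=
  ⟨(TopCat.homeoOfIso (asIso (SSet.toTop.map f))).toHomotopyEquiv, rfl⟩

lemma IsWeakEquivalence.comp {X Y Z : SSet.{u}} {f : X ⟶ Y} {g : Y ⟶ Z}
    (hf : IsWeakEquivalence f) (hg : IsWeakEquivalence g) : IsWeakEquivalence (f ≫ g) := by
  obtain ⟨e, he⟩ := hf
  obtain ⟨e', he'⟩ := hg
  refine ⟨e.trans e', ?_⟩
  rw [Functor.map_comp, TopCat.hom_comp, ← he, ← he']
  rfl

end WeakEquivalence

section Square

lemma isPushout_of_iso_comp {𝒞 : Type*} [Category 𝒞] {A B B' C D D' : 𝒞} {i : A ⟶ B} {k : A ⟶ C}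
    {h : B ⟶ D} {j : C ⟶ D} (sq : IsPushout i k h j) (e : B ≅ B') (e' : D ≅ D') {i' : A ⟶ B'}
    {h' : B' ⟶ D'} {j' : C ⟶ D'} (hi : i ≫ e.hom = i') (hh : h ≫ e'.hom = e.hom ≫ h')
    (hj : j ≫ e'.hom = j') : IsPushout i' k h' j' :=
  IsPushout.of_iso sq (Iso.refl _) e (Iso.refl _) e' (by simpa using hi) (by simp) hh
    (by simpa using hj)

/-- The inclusion of `A` in a collage, as a morphism of small categories. -/
def catInclA {V A : Cat.{u, u}} (R : PartialFunctor V A) : A ⟶ Cat.of (Collage R) :=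
  (inclA R).toCatHom

/-- The functor between collages given by a functor `A ⥤ C`, as a morphism of small categories. -/
def catMap {V A C : Cat.{u, u}} (R : PartialFunctor V A) (k : A ⟶ C) :
    Cat.of (Collage R) ⟶ Cat.of (Collage (R.comp k.toFunctor)) :=
  (map R k.toFunctor).toCatHom

lemma isPushout_cat {V A C : Cat.{u, u}} (R : PartialFunctor V A) (k : A ⟶ C) :
    IsPushout (catInclA R) k (catMap R k) (catInclA (R.comp k.toFunctor)) :=
  isPushout_collage R k.toFunctor

variable {A B C D : Cat.{u, u}} {i : A ⟶ B} {k : A ⟶ C} {h : B ⟶ D} {j : C ⟶ D}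

/-- A square of categories that is isomorphic to the square of a collage of a partial functor `R`
and the collage of `R.comp k`. -/
structure CollageSquare (i : A ⟶ B) (k : A ⟶ C) (h : B ⟶ D) (j : C ⟶ D) where
  /-- the complement of `A` in `B` -/
  V : Cat.{u, u}
  /-- the partial functor -/
  R : PartialFunctor V A
  /-- the identification of `B` with a collage -/
  eB : Cat.of (Collage R) ≅ B
  /-- the identification of `D` with a collage -/
  eD : Cat.of (Collage (R.comp k.toFunctor)) ≅ D
  inclA_eB : catInclA R ≫ eB.hom = i
  map_eD : catMap R k ≫ eD.hom = eB.hom ≫ h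
  inclA_eD : catInclA (R.comp k.toFunctor) ≫ eD.hom = j

/-- Once `B` is a collage, uniqueness of pushouts identifies `D` with the collage of `R.comp k`. -/
lemma IsDwyerMap.exists_collageSquare (sq : IsPushout i k h j) (hi : IsDwyerMap i.toFunctor) :
    Nonempty (CollageSquare i k h j) := by
  obtain ⟨V, R, e, he⟩ := hi.exists_collage
  have he' : catInclA R ≫ e.hom = i := he
  have sq' : IsPushout i k (e.inv ≫ catMap R k) (catInclA (R.comp k.toFunctor)) :=
    isPushout_of_iso_comp (isPushout_cat R k) e (Iso.refl _) he' (by simp) (by simp)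
  refine ⟨⟨V, R, e, sq'.isoIsPushout B C sq, he', ?_, sq'.inr_isoIsPushout_hom B C sq⟩⟩
  rw [← Iso.inv_comp_eq, ← Category.assoc]
  exact sq'.inl_isoIsPushout_hom B C sq

namespace CollageSquare

lemma isPushout (S : CollageSquare i k h j) : IsPushout i k h j :=
  isPushout_of_iso_comp (isPushout_cat S.R k) S.eB S.eD S.inclA_eB S.map_eD S.inclA_eD

lemma isWeakEquivalence (S : CollageSquare i k h j)
    (φ : pushout (nerveFunctor.map i) (nerveFunctor.map k) ⟶ nerveFunctor.obj D)
    (hl : pushout.inl _ _ ≫ φ = nerveFunctor.map h)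
    (hr : pushout.inr _ _ ≫ φ = nerveFunctor.map j) : IsWeakEquivalence φ := by
  have sq : IsPushout (nerveFunctor.map (catInclA S.R)) (nerveFunctor.map k)
      (nerveFunctor.map S.eB.hom ≫ pushout.inl (nerveFunctor.map i) (nerveFunctor.map k))
      (pushout.inr _ _) := by
    refine isPushout_of_iso_comp
      (IsPushout.of_hasPushout (nerveFunctor.map i) (nerveFunctor.map k))
      (nerveFunctor.mapIso S.eB.symm) (Iso.refl _) ?_ ?_ (Category.comp_id _)
    · have e := congrArg (· ≫ S.eB.inv) S.inclA_eB
      simp only [Category.assoc, Iso.hom_inv_id, Category.comp_id] at e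
      rw [e, Functor.map_comp]
      rfl
    · rw [Functor.mapIso_hom, Iso.symm_hom, ← Functor.map_comp_assoc, Iso.inv_hom_id,
        CategoryTheory.Functor.map_id, Category.id_comp]
      exact Category.comp_id _
  have hl' : (nerveFunctor.map S.eB.hom ≫ pushout.inl _ _) ≫ φ ≫ nerveFunctor.map S.eD.inv =
      nerveFunctor.map (catMap S.R k) := by
    rw [Category.assoc, reassoc_of% hl, ← Functor.map_comp, ← Functor.map_comp,
      ← reassoc_of% S.map_eD, Iso.hom_inv_id, Category.comp_id]
  have hr' : pushout.inr _ _ ≫ φ ≫ nerveFunctor.map S.eD.inv =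
      nerveFunctor.map (catInclA (S.R.comp k.toFunctor)) := by
    have e := congrArg (· ≫ S.eD.inv) S.inclA_eD
    simp only [Category.assoc, Iso.hom_inv_id, Category.comp_id] at e
    rw [reassoc_of% hr, ← Functor.map_comp, e]
  have key : IsWeakEquivalence (φ ≫ nerveFunctor.map S.eD.inv) :=
    isWeakEquivalence_collage (R := S.R) (k := k.toFunctor) sq _ hl' hr'
  have := key.comp (isWeakEquivalence_of_isIso (nerveFunctor.map S.eD.hom))
  rwa [Category.assoc, ← Functor.map_comp, Iso.inv_hom_id, CategoryTheory.Functor.map_id, Category.comp_id] at this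

lemma exists_exp (S : CollageSquare i k h j) (I : Type u) [Category.{u} I] [Nonempty I]
    (hI : IsStronglyConnected I) :
    Nonempty (CollageSquare ((Cat.exp.{u, u, u, u} I).map i) ((Cat.exp.{u, u, u, u} I).map k)
      ((Cat.exp.{u, u, u, u} I).map h) ((Cat.exp.{u, u, u, u} I).map j)) := by
  have h1 := isIso_toCatHom _ (expCollage_bijective I S.R hI)
  have h2 := isIso_toCatHom _ (expCollage_bijective I (S.R.comp k.toFunctor) hI)
  refine ⟨⟨Cat.of (I ⥤ S.V), S.R.exp I,
    @asIso _ _ _ _ (expCollage I S.R).toCatHom h1 ≪≫ (Cat.exp.{u, u, u, u} I).mapIso S.eB,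
    @asIso _ _ _ _ (expCollage I (S.R.comp k.toFunctor)).toCatHom h2 ≪≫
      (Cat.exp.{u, u, u, u} I).mapIso S.eD, ?_, ?_, ?_⟩⟩
  · exact congrArg (Cat.exp.{u, u, u, u} I).map S.inclA_eB
  · have e1 := congrArg (Cat.exp.{u, u, u, u} I).map S.map_eD
    have e2 := congrArg Functor.toCatHom (map_expCollage I S.R k.toFunctor)
    rw [Functor.map_comp, Functor.map_comp] at e1
    refine (congrArg (· ≫ (Cat.exp.{u, u, u, u} I).map S.eD.hom) e2).trans ?_
    exact congrArg ((expCollage I S.R).toCatHom ≫ ·) e1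
  · exact congrArg (Cat.exp.{u, u, u, u} I).map S.inclA_eD

end CollageSquare

lemma isIso_exp_map (I : Type u) [Category.{u} I] [IsEmpty I] (f : A ⟶ B) :
    IsIso ((Cat.exp.{u, u, u, u} I).map f) := by
  let L := (Functor.whiskeringRight I A B).obj f.toFunctor
  have : L.Full := ⟨fun _ => ⟨⟨fun i => isEmptyElim i, fun i => isEmptyElim i⟩,
    NatTrans.ext (funext fun i => isEmptyElim i)⟩⟩
  have : L.Faithful := ⟨fun _ => NatTrans.ext (funext fun i => isEmptyElim i)⟩
  refine isIso_toCatHom L ⟨fun F G _ => ?_, fun F => ⟨?_, ?_⟩⟩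
  · exact CategoryTheory.Functor.ext (fun i => isEmptyElim i) fun i => isEmptyElim i
  · exact
      { obj := fun i => isEmptyElim i
        map := fun {i} => isEmptyElim i
        map_id := fun i => isEmptyElim i
        map_comp := fun {i} => isEmptyElim i }
  · exact CategoryTheory.Functor.ext (fun i => isEmptyElim i) fun i => isEmptyElim i

end Square
end DwyerPushout

theorem mainTheorem6 {A B C D : Cat.{u, u}} {i : A ⟶ B} {k : A ⟶ C} {h : B ⟶ D} {j : C ⟶ D}
    (sq : IsPushout i k h j) (hi : DwyerPushout.IsDwyerMap i.toFunctor)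
    (I : Type u) [Category.{u} I] (hI : DwyerPushout.IsStronglyConnected I) :
    IsPushout ((Cat.exp.{u, u, u, u} I).map i) ((Cat.exp.{u, u, u, u} I).map k)
        ((Cat.exp.{u, u, u, u} I).map h) ((Cat.exp.{u, u, u, u} I).map j) ∧
      DwyerPushout.IsWeakEquivalence (DwyerPushout.nerveFunDesc I sq.toCommSq) := by
  -- For empty `I` the collage of `R.exp I` has two objects while the functor category has one, so
  -- this case is separate: there the functor categories are terminal and all maps are isomorphisms.
  cases isEmpty_or_nonempty I with
  | inl hI₀ =>
    have h1 := DwyerPushout.isIso_exp_map I i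
    have h2 := DwyerPushout.isIso_exp_map I j
    have h3 : IsIso ((DwyerPushout.nerveFun I).map i) :=
      inferInstanceAs (IsIso (nerveFunctor.map ((Cat.exp.{u, u, u, u} I).map i)))
    have h4 : IsIso ((DwyerPushout.nerveFun I).map j) :=
      inferInstanceAs (IsIso (nerveFunctor.map ((Cat.exp.{u, u, u, u} I).map j)))
    have sq' := sq.toCommSq.map (Cat.exp.{u, u, u, u} I)
    refine ⟨IsPushout.of_horiz_isIso sq', ?_⟩
    have h5 : pushout.inr _ _ ≫ DwyerPushout.nerveFunDesc I sq.toCommSq =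
      (DwyerPushout.nerveFun I).map j := pushout.inr_desc _ _ _
    have h6 : IsIso (pushout.inr _ _ ≫ DwyerPushout.nerveFunDesc I sq.toCommSq) := h5 ▸ h4
    have h7 : IsIso (DwyerPushout.nerveFunDesc I sq.toCommSq) := IsIso.of_isIso_comp_left
      (pushout.inr ((DwyerPushout.nerveFun I).map i) ((DwyerPushout.nerveFun I).map k)) _
    exact DwyerPushout.isWeakEquivalence_of_isIso _
  | inr hI₀ =>
    obtain ⟨S⟩ := hi.exists_collageSquare sq
    obtain ⟨T⟩ := S.exists_exp I hI
    exact ⟨T.isPushout, T.isWeakEquivalence _ (pushout.inl_desc _ _ _) (pushout.inr_desc _ _ _)⟩
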